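/- Let $r\ge 3$ and $n\ge r+2$ be integers, and let $\mathcal H=(V,\mathcal E)$ be an $r$-graph ($r$-uniform hypergraph) on $n$ vertices, i.e. $|V|=n$ and $\mathcal E$ is a set of $r$-element subsets of $V$. Let $$\lambda(\mathcal H)=\max\Big\{\,r\sum_{\{i_1,\dots,i_r\}\in\mathcal E}x_{i_1}\cdots x_{i_r}\;:\;x\in\mathbb R^V,\ \sum_{i\in V}|x_i|^r=1\Big\}$$ be its spectral radius. A Hamiltonian Berge cycle in $\mathcal H$ consists of an ordering $v_1,\dots,v_n$ of all the vertices and $n$ distinct edges $e_1,\dots,e_n\in\mathcal E$ such that $v_i\in e_i\cap e_{i+1}$ for $1\le i\le n-1$ and $v_n\in e_n\cap e_1$. A Hamiltonian Berge path consists of an ordering $v_1,\dots,v_n$ of all the vertices and $n-1$ distinct edges $e_1,\dots,e_{n-1}\in\mathcal E$ such that $v_i,v_{i+1}\in e_i$ for $1\le i\le n-1$. Let $K_{n-1}^r+v$ denote the $r$-graph on $n$ vertices whose edges are all the $r$-element subsets of the vertex set that do not contain the vertex $v$, and let $K_{n-1}^r+e$ denote $K_{n-1}^r+v$ with one additional edge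 $e$ ($|e|=r$) containing $v$; this is unique up to isomorphism. 1. If $\lambda(\mathcal H)\ge\binom{n-2}{r-1}$, then $\mathcal H$ contains a Hamiltonian Berge path unless $\mathcal H\cong K_{n-1}^r+v$. 2. If $\lambda(\mathcal H)>\binom{n-2}{r-1}$, then $\mathcal H$ contains a Hamiltonian Berge cycle unless $\mathcal H\cong K_{n-1}^r+e$. -/

import Mathlib

open scoped BigOperators

/-- An `r`-graph (`r`-uniform hypergraph) on the vertex set `V`: a set of `r`-element subsets of
`V`, called edges. -/
structure RGraph (V : Type*) (r : ℕ) where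
  edges : Finset (Finset V)
  uniform : ∀ e ∈ edges, e.card = r

namespace RGraph

variable {V W : Type*} {r : ℕ}

/-- Isomorphism of `r`-graphs: a bijection of the vertex sets that induces a bijection of the
edge sets. -/
def Isomorphic (H : RGraph V r) (G : RGraph W r) : Prop :=
  ∃ σ : V ≃ W, ∀ e : Finset V, e ∈ H.edges ↔ e.map σ.toEmbedding ∈ G.edges

/-- The polynomial form `P_H(x) = r * ∑_{e ∈ E(H)} ∏_{i ∈ e} x_i`. -/
def polyForm (H : RGraph V r) (x : V → ℝ) : ℝ :=
  (r : ℝ) * ∑ e ∈ H.edges, ∏ i ∈ e, x i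

/-- The spectral radius: the maximum of the polynomial form over all real vectors `x` of
`ℓ_r`-norm one, that is, with `∑ |x_i| ^ r = 1`. For `r ≥ 1` and a nonempty finite vertex set
the supremum is a maximum, see `isGreatest_spectralRadius`. -/
noncomputable def spectralRadius [Fintype V] (H : RGraph V r) : ℝ :=
  sSup (H.polyForm '' {x : V → ℝ | ∑ i, |x i| ^ r = 1})

/-- The spectral radius is an attained maximum. -/
theorem isGreatest_spectralRadius [Fintype V] [Nonempty V] (hr : 1 ≤ r) (H : RGraph V r) :
    IsGreatest (H.polyForm '' {x : V → ℝ | ∑ i, |x i| ^ r = 1}) H.spectralRadius := by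
  classical
  have hne : ({x : V → ℝ | ∑ i, |x i| ^ r = 1}).Nonempty := by
    obtain ⟨v⟩ := ‹Nonempty V›
    refine ⟨Pi.single v 1, ?_⟩
    rw [Set.mem_ofPred_eq, Finset.sum_eq_single v]
    · simp
    · intro b _ hb
      simp [Pi.single_eq_of_ne hb, show r ≠ 0 by omega]
    · simp
  have hclosed : IsClosed {x : V → ℝ | ∑ i, |x i| ^ r = 1} :=
    isClosed_eq (by fun_prop) continuous_const
  have hbdd : Bornology.IsBounded {x : V → ℝ | ∑ i, |x i| ^ r = 1} := by
    refine (Metric.isBounded_closedBall (x := (0 : V → ℝ)) (r := 1)).subset ?_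
    intro x hx
    rw [mem_closedBall_zero_iff, pi_norm_le_iff_of_nonneg zero_le_one]
    intro i
    have h1 : |x i| ^ r ≤ 1 := by
      rw [← (show ∑ i, |x i| ^ r = 1 from hx)]
      exact Finset.single_le_sum (f := fun i => |x i| ^ r)
        (fun j _ => pow_nonneg (abs_nonneg _) _) (Finset.mem_univ i)
    exact (pow_le_one_iff_of_nonneg (abs_nonneg _) (by omega)).1 h1
  have hcont : Continuous H.polyForm := by
    unfold polyForm
    fun_prop
  exact ((Metric.isCompact_of_isClosed_isBounded hclosed hbdd).image hcont).isGreatest_sSup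
    (hne.image _)

/-- A Berge cycle of length `ℓ`: distinct edges `e_i` and distinct vertices `v_i`, indexed
cyclically, with `v_i ∈ e_i ∩ e_{i+1}` (`finRotate ℓ` is `i ↦ i + 1` modulo `ℓ`). -/
structure BergeCycle (H : RGraph V r) (ℓ : ℕ) where
  vert : Fin ℓ → V
  edge : Fin ℓ → Finset V
  vert_injective : Function.Injective vert
  edge_injective : Function.Injective edge
  edge_mem : ∀ i, edge i ∈ H.edges
  vert_mem_edge : ∀ i, vert i ∈ edge i
  vert_mem_edge_next : ∀ i, vert i ∈ edge (finRotate ℓ i)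

/-- A Berge path `v_0, e_0, v_1, e_1, …, e_{k-1}, v_k` with `k` edges and `k + 1` vertices, all
distinct, and `v_i, v_{i+1} ∈ e_i`: the cyclic pattern of a Berge cycle on `k + 1` vertices with
one of its edges left out. -/
structure BergePath (H : RGraph V r) (k : ℕ) where
  vert : Fin (k + 1) → V
  edge : Fin k → Finset V
  vert_injective : Function.Injective vert
  edge_injective : Function.Injective edge
  edge_mem : ∀ i, edge i ∈ H.edges
  vert_castSucc_mem : ∀ i : Fin k, vert i.castSucc ∈ edge i
  vert_succ_mem : ∀ i : Fin k, vert i.succ ∈ edge i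

/-- `H` contains a Berge cycle whose vertices `v_i` are all the vertices of `H`. -/
def HasHamiltonianBergeCycle (H : RGraph V r) : Prop :=
  ∃ (ℓ : ℕ) (C : H.BergeCycle ℓ), Function.Surjective C.vert

/-- `H` contains a Berge path whose vertices `v_i` are all the vertices of `H`. -/
def HasHamiltonianBergePath (H : RGraph V r) : Prop :=
  ∃ (k : ℕ) (P : H.BergePath k), Function.Surjective P.vert

/-- The complete `r`-graph `K_m^r`. -/
def complete (m r : ℕ) : RGraph (Fin m) r where
  edges := Finset.powersetCard r Finset.univ
  uniform := fun _ he => (Finset.mem_powersetCard.1 he).2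

/-- `G + v`: the `r`-graph `G` together with one new isolated vertex `v`, which is `none`. -/
def addVertex (G : RGraph W r) : RGraph (Option W) r where
  edges := G.edges.map (Finset.mapEmbedding Function.Embedding.some).toEmbedding
  uniform := by
    intro e he
    obtain ⟨f, hf, rfl⟩ := Finset.mem_map.1 he
    simpa using G.uniform f hf

/-- The `r`-graph `G` together with the additional edge `e`. -/
def addEdge [DecidableEq W] (G : RGraph W r) (e : Finset W) (he : e.card = r) : RGraph W r where
  edges := insert e G.edges
  uniform := by
    intro f hf
    rcases Finset.mem_insert.1 hf with rfl | hf
    · exact he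
    · exact G.uniform f hf

/-- `H ≅ K_m^r + v`: a clique on `m` vertices together with an isolated vertex. -/
def IsCompletePlusVertex (H : RGraph V r) (m : ℕ) : Prop :=
  H.Isomorphic (complete m r).addVertex

/-- `H ≅ K_m^r + e`: the `r`-graph `K_m^r + v` with one additional edge `e` incident to `v`.
(All choices of `e` give isomorphic `r`-graphs.) -/
def IsCompletePlusEdge (H : RGraph V r) (m : ℕ) : Prop :=
  ∃ (e : Finset (Option (Fin m))) (he : e.card = r),
    none ∈ e ∧ H.Isomorphic ((complete m r).addVertex.addEdge e he)

end RGraph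

/-!
The proof has a spectral and a combinatorial half, joined by the number of edges.

**Spectral half.** If `λ(H) ≥ C(n-2, r-1)` then `H` has at least `C(n-1, r)` edges, and strict
inequality is preserved (`RGraph.mul_spectralRadius_le_card`). Choose a random ordered edge
`(X₁, …, X_r)`, an edge `e` having probability proportional to `∏ i ∈ e, x i` for a maximizer `x`,
and let `h_k` be the entropy of `X_k` given `X₁, …, X_{k-1}`. Gibbs' inequality for the laws of `X₁`
and `x i ^ r` shows that `h₂ + … + h_r` is at least `log ((r-1)! λ(H))`. For an exchangeable pair of
distinct variables `exp H(X₁) ≥ exp H(X₂ | X₁) + 1` (`RGraph.exchangeable_entropy_le` is the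
linearised form), so `exp h_k ≥ exp h_{k+1} + 1`. Hence, with `m = n - 1`, if `exp h₁ < m` then
`exp h_k < m - k + 1` for all `k`, contradicting the lower bound for `h₂ + … + h_r`. So
`exp h₁ ≥ m`, and `r! |E| ≥ exp (h₁ + … + h_r) ≥ m (r-1)! λ(H)`.

**Combinatorial half.** If there are more than `C(n-1, r)` edges and all degrees are at least two,
there is a Hamiltonian Berge cycle (`RGraph.exists_isHamCycle_of_choose_lt_card`), by induction on
`n`. Deleting a vertex `v` of minimum degree `δ` preserves the hypotheses, and leaves an `r`-graph
with at most `δ - 1` missing edges. Either `v` can be inserted between two consecutive vertices of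
a cycle avoiding it, or a segment between two neighbours of `v` can be reversed, provided that some
free edge joins the successors of the two neighbours. If all of this fails, the `r`-sets containing
such a pair of successors are missing or lie on the cycle, and there are too many of them for that
(`RGraph.card_add_card_le_of_linked`). In the base case `n = r + 2` every edge misses just two
vertices, and Hall's theorem assigns edges to the consecutive pairs of a suitable cyclic order;
`r = 3` with five vertices is a finite computation.

With more than `C(n-1, r)` edges, a vertex of degree at most one forces `H ≅ K_{n-1}^r + e`. With at
least `C(n-1, r)` edges, an isolated vertex forces `H ≅ K_{n-1}^r + v`; if there is none, one added
edge produces a Hamiltonian Berge cycle, and its removal a Hamiltonian Berge path.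
-/

/-! ### Entropy inequalities on tuples of vertices -/

namespace RGraph

/-- The sum of `φ` over all lists of length `j`, i.e. over all `j`-tuples. -/
def tupleSum {V : Type*} [Fintype V] : ℕ → (List V → ℝ) → ℝ
  | 0, φ => φ []
  | j + 1, φ => tupleSum j fun l => ∑ v, φ (v :: l)

section tupleSum

variable {V : Type*} [Fintype V]

theorem tupleSum_mono (j : ℕ) {φ ψ : List V → ℝ} (h : ∀ l, l.length = j → φ l ≤ ψ l) :
    tupleSum j φ ≤ tupleSum j ψ := by
  induction j generalizing φ ψ with
  | zero => exact h [] rfl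
  | succ j ih =>
    exact ih fun l hl => Finset.sum_le_sum fun v _ => h (v :: l) (by simp [hl])

theorem tupleSum_congr (j : ℕ) {φ ψ : List V → ℝ} (h : ∀ l, l.length = j → φ l = ψ l) :
    tupleSum j φ = tupleSum j ψ :=
  le_antisymm (tupleSum_mono j fun l hl => (h l hl).le) (tupleSum_mono j fun l hl => (h l hl).ge)

theorem tupleSum_add (j : ℕ) (φ ψ : List V → ℝ) :
    tupleSum j (fun l => φ l + ψ l) = tupleSum j φ + tupleSum j ψ := by
  induction j generalizing φ ψ with
  | zero => rfl
  | succ j ih => simp only [tupleSum, Finset.sum_add_distrib, ih]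

theorem tupleSum_const_mul (j : ℕ) (a : ℝ) (φ : List V → ℝ) :
    tupleSum j (fun l => a * φ l) = a * tupleSum j φ := by
  induction j generalizing φ with
  | zero => rfl
  | succ j ih => simp only [tupleSum, ← Finset.mul_sum, ih]

end tupleSum

/-- The summand of Gibbs' inequality. The junk value `Real.log 0 = 0` is harmless, as it only occurs
for `a = 0`. -/
theorem sub_le_mul_log_sub {a b : ℝ} (ha : 0 ≤ a) (hb : 0 ≤ b) (hab : b = 0 → a = 0) :
    a - b ≤ a * (Real.log a - Real.log b) := by
  rcases ha.eq_or_lt with rfl | ha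
  · simpa using hb
  have hb : 0 < b := lt_of_le_of_ne hb fun h => ha.ne' (hab h.symm)
  have h := Real.log_le_sub_one_of_pos (div_pos hb ha)
  rw [Real.log_div hb.ne' ha.ne'] at h
  have h2 := mul_le_mul_of_nonneg_left h ha.le
  have h3 : a * (b / a - 1) = b - a := by field_simp
  nlinarith

/-- For an exchangeable pair `(X₁, X₂)` of almost surely different random variables, with
unnormalised law `f`, this is the inequality `H(X₁) ≥ h(p) + p * H(X₂ | X₁)`, `h` being the binary
entropy. It is the nonnegativity of the mutual information of `X₁` and `Y`, where `Y` is `X₂` with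
probability `p` and `X₁` otherwise. -/
theorem exchangeable_entropy_le {V : Type*} [Fintype V] (f : V → V → ℝ)
    (f_nonneg : ∀ u v, 0 ≤ f u v) (f_symm : ∀ u v, f u v = f v u) (f_diag : ∀ u, f u u = 0)
    (g : V → ℝ) (hg : ∀ u, g u = ∑ v, f u v) (T : ℝ) (hT : T = ∑ u, g u)
    (p : ℝ) (hp0 : 0 < p) (hp1 : p < 1) :
    T * (-(p * Real.log p) - (1 - p) * Real.log (1 - p)) ≤
      T * Real.log T - (1 + p) * ∑ u, g u * Real.log (g u) +
        p * ∑ u, ∑ v, f u v * Real.log (f u v) := by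
  classical
  have hq : 0 < 1 - p := by linarith
  have g_nonneg : ∀ u, 0 ≤ g u := fun u => hg u ▸ Finset.sum_nonneg fun v _ => f_nonneg u v
  have hfg : ∀ u v, g u = 0 → f u v = 0 := fun u v h =>
    (Finset.sum_eq_zero_iff_of_nonneg fun v _ => f_nonneg u v).1 ((hg u).symm.trans h) v
      (Finset.mem_univ v)
  have hgT : ∀ u, T = 0 → g u = 0 := fun u h =>
    (Finset.sum_eq_zero_iff_of_nonneg fun v _ => g_nonneg v).1 (hT.symm.trans h) u
      (Finset.mem_univ u)
  have hT0 : 0 ≤ T := hT ▸ Finset.sum_nonneg fun v _ => g_nonneg v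
  rcases hT0.eq_or_lt with hT1 | hTpos
  · have h1 : ∀ u, g u = 0 := fun u => hgT u hT1.symm
    have h2 : ∀ u v, f u v = 0 := fun u v => hfg u v (h1 u)
    simp [h1, h2, ← hT1]
  -- the joint law of `(X₁, Y)` against the product of its marginals
  have key : ∀ u v, (p * f u v + if u = v then (1 - p) * g u else 0) - g u * g v / T ≤
      p * f u v * (Real.log p + Real.log (f u v) + Real.log T - Real.log (g u) - Real.log (g v)) +
      if u = v then (1 - p) * g u * (Real.log (1 - p) + Real.log T - Real.log (g u)) else 0 := by
    intro u v
    by_cases huv : u = v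
    · subst huv
      simp only [f_diag, if_true, mul_zero, zero_mul, zero_add]
      rcases (g_nonneg u).eq_or_lt with h0 | h0
      · simp [← h0]
      refine (sub_le_mul_log_sub (by positivity) (by positivity) fun h => ?_).trans (le_of_eq ?_)
      · have : 0 < g u * g u / T := by positivity
        exact absurd h this.ne'
      · rw [Real.log_mul hq.ne' h0.ne', Real.log_div (by positivity) hTpos.ne',
          Real.log_mul h0.ne' h0.ne']
        ring
    · simp only [huv, if_false, add_zero]
      rcases (f_nonneg u v).eq_or_lt with h0 | h0
      · rw [← h0]
        have : 0 ≤ g u * g v / T := div_nonneg (mul_nonneg (g_nonneg u) (g_nonneg v)) hT0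
        simpa using this
      have hu : 0 < g u := lt_of_le_of_ne (g_nonneg u) fun h => h0.ne' (hfg u v h.symm)
      have hv : 0 < g v := lt_of_le_of_ne (g_nonneg v) fun h =>
        h0.ne' ((f_symm u v).trans (hfg v u h.symm))
      refine (sub_le_mul_log_sub (by positivity) (by positivity) fun h => ?_).trans (le_of_eq ?_)
      · have : 0 < g u * g v / T := by positivity
        exact absurd h this.ne'
      · rw [Real.log_mul hp0.ne' h0.ne', Real.log_div (by positivity) hTpos.ne',
          Real.log_mul hu.ne' hv.ne']
        ring
  have hsum := Finset.sum_le_sum fun u (_ : u ∈ Finset.univ) =>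
    Finset.sum_le_sum fun v (_ : v ∈ Finset.univ) => key u v
  have hleft : ∑ u, ∑ v, ((p * f u v + if u = v then (1 - p) * g u else 0) - g u * g v / T) = 0 := by
    have h1 : ∀ u, ∑ v, ((p * f u v + if u = v then (1 - p) * g u else 0) - g u * g v / T) = 0 := by
      intro u
      rw [Finset.sum_sub_distrib, Finset.sum_add_distrib, ← Finset.mul_sum, ← hg, ← Finset.sum_div,
        ← Finset.mul_sum, ← hT]
      simp only [Finset.sum_ite_eq, Finset.mem_univ, if_true]
      field_simp
      ring
    exact Finset.sum_eq_zero fun u _ => h1 u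
  rw [hleft] at hsum
  have hgv : ∑ u, ∑ v, f u v * Real.log (g v) = ∑ u, g u * Real.log (g u) := by
    rw [Finset.sum_comm]
    refine Finset.sum_congr rfl fun u _ => ?_
    rw [← Finset.sum_mul, hg]
    simp only [f_symm u]
  have hright : ∑ u, ∑ v, (p * f u v *
        (Real.log p + Real.log (f u v) + Real.log T - Real.log (g u) - Real.log (g v)) +
      if u = v then (1 - p) * g u * (Real.log (1 - p) + Real.log T - Real.log (g u)) else 0) =
      p * (Real.log p + Real.log T) * T + p * ∑ u, ∑ v, f u v * Real.log (f u v)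
        - p * ∑ u, g u * Real.log (g u) - p * ∑ u, ∑ v, f u v * Real.log (g v)
        + (1 - p) * (Real.log (1 - p) + Real.log T) * T
        - (1 - p) * ∑ u, g u * Real.log (g u) := by
    have h1 : ∀ u, ∑ v, (p * f u v *
        (Real.log p + Real.log (f u v) + Real.log T - Real.log (g u) - Real.log (g v)) +
      if u = v then (1 - p) * g u * (Real.log (1 - p) + Real.log T - Real.log (g u)) else 0) =
      p * (Real.log p + Real.log T) * g u + p * ∑ v, f u v * Real.log (f u v)
        - p * (g u * Real.log (g u)) - p * ∑ v, f u v * Real.log (g v)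
        + (1 - p) * (Real.log (1 - p) + Real.log T) * g u
        - (1 - p) * (g u * Real.log (g u)) := by
      intro u
      rw [Finset.sum_add_distrib]
      simp only [Finset.sum_ite_eq, Finset.mem_univ, if_true]
      have h2 : ∑ v, p * f u v *
          (Real.log p + Real.log (f u v) + Real.log T - Real.log (g u) - Real.log (g v)) =
          p * (Real.log p + Real.log T - Real.log (g u)) * (∑ v, f u v)
          + p * (∑ v, f u v * Real.log (f u v)) - p * ∑ v, f u v * Real.log (g v) := by
        simp only [Finset.mul_sum, ← Finset.sum_add_distrib, ← Finset.sum_sub_distrib]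
        exact Finset.sum_congr rfl fun v _ => by ring
      rw [h2, ← hg]
      ring
    simp only [h1, Finset.sum_add_distrib, Finset.sum_sub_distrib, ← Finset.mul_sum, ← hT]
  rw [hright, hgv] at hsum
  linarith

/-! ### Extension weights of tuples -/

/-- The weight of a tuple `l` of distinct vertices: the sum of `φ e` over all orderings of the edges
`e ∈ E` which continue `l`. It is zero if `l` has a repetition. -/
def extWeight {V : Type*} [DecidableEq V] (E : Finset (Finset V)) (r : ℕ) (φ : Finset V → ℝ)
    (l : List V) : ℝ :=
  if l.Nodup then ((r - l.length).factorial : ℝ) * ∑ e ∈ E with l.toFinset ⊆ e, φ e else 0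

section extWeight

variable {V : Type*} [DecidableEq V] {E : Finset (Finset V)} {r : ℕ} {φ : Finset V → ℝ}

theorem extWeight_nil : extWeight E r φ [] = r.factorial * ∑ e ∈ E, φ e := by
  simp [extWeight]

theorem extWeight_nonneg (hφ : ∀ e ∈ E, 0 ≤ φ e) (l : List V) : 0 ≤ extWeight E r φ l := by
  unfold extWeight
  split_ifs
  · exact mul_nonneg (by positivity) (Finset.sum_nonneg fun e he => hφ e (Finset.mem_filter.1 he).1)
  · exact le_rfl

theorem extWeight_perm {l l' : List V} (h : l.Perm l') : extWeight E r φ l = extWeight E r φ l' := by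
  unfold extWeight
  rw [h.length_eq, List.toFinset_eq_of_perm _ _ h]
  simp only [h.nodup_iff]

/-- Weights are marginals: summing over the next vertex gives the weight of the shorter tuple. -/
theorem sum_extWeight_cons [Fintype V] (hE : ∀ e ∈ E, e.card = r) {l : List V}
    (hl : l.length < r) : ∑ v, extWeight E r φ (v :: l) = extWeight E r φ l := by
  by_cases hnd : l.Nodup
  swap
  · simp [extWeight, hnd]
  have h1 : ∀ v, extWeight E r φ (v :: l) = ((r - l.length - 1).factorial : ℝ) *
      ∑ e ∈ E with l.toFinset ⊆ e, if v ∈ e \ l.toFinset then φ e else 0 := by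
    intro v
    by_cases hv : v ∈ l
    · simp [extWeight, hv]
    · rw [extWeight, if_pos (List.nodup_cons.2 ⟨hv, hnd⟩), List.length_cons, Nat.sub_add_eq,
        ← Finset.sum_filter, Finset.filter_filter]
      congr 2
      ext e
      simp only [List.toFinset_cons, Finset.mem_filter, Finset.insert_subset_iff, Finset.mem_sdiff,
        List.mem_toFinset]
      tauto
  simp only [h1]
  rw [← Finset.mul_sum, Finset.sum_comm]
  have h2 : ∀ e ∈ E.filter (l.toFinset ⊆ ·), (∑ v, if v ∈ e \ l.toFinset then φ e else 0) =
      ((r - l.length : ℕ) : ℝ) * φ e := by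
    intro e he
    rw [Finset.mem_filter] at he
    rw [Finset.sum_ite_mem, Finset.univ_inter, Finset.sum_const, nsmul_eq_mul,
      Finset.card_sdiff_of_subset he.2, hE e he.1, List.toFinset_card_of_nodup hnd]
  rw [Finset.sum_congr rfl h2, ← Finset.mul_sum, ← mul_assoc, extWeight, if_pos hnd]
  congr 1
  obtain ⟨k, hk⟩ : ∃ k, r - l.length = k + 1 := ⟨r - l.length - 1, by omega⟩
  rw [hk, Nat.add_sub_cancel, Nat.factorial_succ]
  push_cast
  ring

theorem tupleSum_extWeight [Fintype V] (hE : ∀ e ∈ E, e.card = r) {j : ℕ} (hj : j ≤ r) :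
    tupleSum j (extWeight E r φ) = r.factorial * ∑ e ∈ E, φ e := by
  induction j with
  | zero => exact extWeight_nil
  | succ j ih =>
    rw [← ih (by omega)]
    exact tupleSum_congr j fun l hl => sum_extWeight_cons hE (by omega)

/-- A tuple of full length has at most one extension, so functions of its weight can be evaluated
edge by edge. -/
theorem map_extWeight (hE : ∀ e ∈ E, e.card = r) (η : ℝ → ℝ) (η0 : η 0 = 0) {l : List V}
    (hl : l.length = r) : η (extWeight E r φ l) = extWeight E r (fun e => η (φ e)) l := by
  unfold extWeight
  by_cases hnd : l.Nodup
  swap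
  · simp [hnd, η0]
  have hfil : (E.filter fun e => l.toFinset ⊆ e) = E.filter (· = l.toFinset) := by
    refine Finset.filter_congr fun e he => ⟨fun h => ?_, fun h => h.ge⟩
    refine (Finset.eq_of_subset_of_card_le h ?_).symm
    rw [hE e he, List.toFinset_card_of_nodup hnd, hl]
  simp only [if_pos hnd, hfil, hl, Nat.sub_self, Nat.factorial_zero, Nat.cast_one, one_mul,
    Finset.filter_eq']
  split_ifs <;> simp [η0]

end extWeight

/-! ### Edge counts from the spectral radius -/

section Spectral

variable {V : Type*} [Fintype V] [DecidableEq V] {E : Finset (Finset V)} {r : ℕ}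

/-- Minus the (unnormalised) entropy of the first `j` vertices of a random ordered edge, an edge
`e` being chosen with probability proportional to `φ e`. -/
noncomputable def tupleNegEntropy (E : Finset (Finset V)) (r : ℕ) (φ : Finset V → ℝ) (j : ℕ) : ℝ :=
  tupleSum j fun l => extWeight E r φ l * Real.log (extWeight E r φ l)

/-- Applied to the vertices `j + 1` and `j + 2` given the first `j`, `exchangeable_entropy_le` compares
consecutive conditional entropies. -/
theorem tupleNegEntropy_step (hE : ∀ e ∈ E, e.card = r) {φ : Finset V → ℝ}
    (hφ : ∀ e ∈ E, 0 ≤ φ e) {j : ℕ} (hj : j + 2 ≤ r) {p : ℝ} (hp0 : 0 < p) (hp1 : p < 1) :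
    (r.factorial * ∑ e ∈ E, φ e) * (-(p * Real.log p) - (1 - p) * Real.log (1 - p)) ≤
      tupleNegEntropy E r φ j - (1 + p) * tupleNegEntropy E r φ (j + 1) +
        p * tupleNegEntropy E r φ (j + 2) := by
  rw [← tupleSum_extWeight (φ := φ) hE (show j ≤ r by omega), mul_comm, ← tupleSum_const_mul]
  have h : ∀ l : List V, l.length = j →
      (-(p * Real.log p) - (1 - p) * Real.log (1 - p)) * extWeight E r φ l ≤
      (extWeight E r φ l * Real.log (extWeight E r φ l) +
        (-(1 + p)) * ∑ u, extWeight E r φ (u :: l) * Real.log (extWeight E r φ (u :: l))) +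
        p * ∑ u, ∑ v, extWeight E r φ (v :: u :: l) * Real.log (extWeight E r φ (v :: u :: l)) := by
    intro l hl
    have := exchangeable_entropy_le (fun u v => extWeight E r φ (v :: u :: l))
      (fun u v => extWeight_nonneg hφ _) (fun u v => extWeight_perm (List.Perm.swap _ _ _))
      (fun u => by simp [extWeight]) (fun u => extWeight E r φ (u :: l))
      (fun u => (sum_extWeight_cons hE (by simp; omega)).symm) (extWeight E r φ l)
      (sum_extWeight_cons hE (by omega)).symm p hp0 hp1
    linarith
  refine (tupleSum_mono j h).trans (le_of_eq ?_)
  rw [tupleSum_add, tupleSum_add, tupleSum_const_mul, tupleSum_const_mul]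
  simp only [tupleNegEntropy, tupleSum]
  ring

theorem tupleNegEntropy_zero {φ : Finset V → ℝ} : tupleNegEntropy E r φ 0 =
    (r.factorial * ∑ e ∈ E, φ e) * Real.log (r.factorial * ∑ e ∈ E, φ e) := by
  simp only [tupleNegEntropy, tupleSum, extWeight_nil]

theorem tupleNegEntropy_self (hE : ∀ e ∈ E, e.card = r) {φ : Finset V → ℝ} :
    tupleNegEntropy E r φ r = r.factorial * ∑ e ∈ E, φ e * Real.log (φ e) := by
  rw [← tupleSum_extWeight hE le_rfl, tupleNegEntropy]
  exact tupleSum_congr r fun l hl => map_extWeight hE (fun t => t * Real.log t) (by simp) hl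

/-- The entropy of an ordered edge is at most the logarithm of the number of ordered edges. -/
theorem tupleNegEntropy_self_ge (hE : ∀ e ∈ E, e.card = r) {φ : Finset V → ℝ}
    (hφ : ∀ e ∈ E, 0 ≤ φ e) (hpos : 0 < ∑ e ∈ E, φ e) :
    (r.factorial * ∑ e ∈ E, φ e) * Real.log ((∑ e ∈ E, φ e) / E.card) ≤
      tupleNegEntropy E r φ r := by
  rw [tupleNegEntropy_self hE, mul_assoc]
  refine mul_le_mul_of_nonneg_left ?_ (by positivity)
  set Q := ∑ e ∈ E, φ e with hQ
  have hcard : (0 : ℝ) < E.card := by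
    rcases E.eq_empty_or_nonempty with h | h
    · simp [hQ, h] at hpos
    · exact_mod_cast h.card_pos
  have h := Finset.sum_le_sum fun e he => sub_le_mul_log_sub (hφ e he)
    (div_nonneg hpos.le hcard.le) fun h => absurd h (div_pos hpos hcard).ne'
  rw [Finset.sum_sub_distrib, Finset.sum_const, nsmul_eq_mul, ← hQ] at h
  have h1 : (E.card : ℝ) * (Q / E.card) = Q := by field_simp
  simp only [mul_sub, Finset.sum_sub_distrib, ← Finset.sum_mul] at h
  linarith

/-- For products of vertex weights the entropy of an ordered edge exceeds that of its first vertex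
by at least the logarithm of the total weight: this is Gibbs' inequality for the law of the first
vertex and the law `x i ^ r`. -/
theorem tupleNegEntropy_self_le (hr : 1 ≤ r) (hE : ∀ e ∈ E, e.card = r) {x : V → ℝ}
    (hx : ∀ i, 0 ≤ x i) (hnorm : ∑ i, x i ^ r = 1) (hpos : 0 < ∑ e ∈ E, ∏ i ∈ e, x i) :
    tupleNegEntropy E r (fun e => ∏ i ∈ e, x i) r ≤
      tupleNegEntropy E r (fun e => ∏ i ∈ e, x i) 1 -
      (r.factorial * ∑ e ∈ E, ∏ i ∈ e, x i) *
        Real.log (r.factorial * ∑ e ∈ E, ∏ i ∈ e, x i) := by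
  set φ : Finset V → ℝ := fun e => ∏ i ∈ e, x i with hφdef
  have hφ : ∀ e ∈ E, 0 ≤ φ e := fun e _ => Finset.prod_nonneg fun i _ => hx i
  set W : ℝ := r.factorial * ∑ e ∈ E, φ e with hW
  have hWpos : 0 < W := mul_pos (by positivity) hpos
  have hd : ∀ u, extWeight E r φ [u] = (r - 1).factorial * ∑ e ∈ E with u ∈ e, φ e := by
    intro u
    simp [extWeight]
  have hsumd : ∑ u, extWeight E r φ [u] = W := by
    rw [sum_extWeight_cons hE (by simp; omega), extWeight_nil]
  -- the edge weights expressed through the law of the first vertex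
  have hlog : tupleNegEntropy E r φ r = ∑ u, extWeight E r φ [u] * (r * Real.log (x u)) := by
    rw [tupleNegEntropy_self hE]
    have h1 : ∀ e ∈ E, φ e * Real.log (φ e) = ∑ u, if u ∈ e then φ e * Real.log (x u) else 0 := by
      intro e _
      rw [Finset.sum_ite_mem, Finset.univ_inter, ← Finset.mul_sum]
      by_cases h0 : φ e = 0
      · simp [h0]
      · congr 1
        exact Real.log_prod fun i hi h => h0 (Finset.prod_eq_zero hi h)
    rw [Finset.sum_congr rfl h1, Finset.sum_comm, Finset.mul_sum]
    refine Finset.sum_congr rfl fun u _ => ?_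
    rw [hd, ← Finset.sum_filter, ← Finset.sum_mul, ← Nat.mul_factorial_pred (by omega : r ≠ 0)]
    push_cast
    ring
  have key : ∀ u, extWeight E r φ [u] - W * x u ^ r ≤ extWeight E r φ [u] *
      (Real.log (extWeight E r φ [u]) - Real.log W - r * Real.log (x u)) := by
    intro u
    rcases (hx u).eq_or_lt with h0 | h0
    · have : extWeight E r φ [u] = 0 := by
        rw [hd, Finset.sum_eq_zero, mul_zero]
        intro e he
        exact Finset.prod_eq_zero (Finset.mem_filter.1 he).2 h0.symm
      rw [this, ← h0]
      simp [show r ≠ 0 by omega]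
    · have hp : 0 < W * x u ^ r := by positivity
      refine (sub_le_mul_log_sub (extWeight_nonneg hφ _) hp.le fun h => absurd h hp.ne').trans
        (le_of_eq ?_)
      rw [Real.log_mul hWpos.ne' (by positivity), Real.log_pow]
      ring
  have hsum := Finset.sum_le_sum fun u (_ : u ∈ Finset.univ) => key u
  rw [Finset.sum_sub_distrib, ← Finset.mul_sum, hnorm, hsumd] at hsum
  simp only [mul_sub, Finset.sum_sub_distrib, ← Finset.sum_mul, hsumd] at hsum
  have h1 : tupleNegEntropy E r φ 1 =
      ∑ u, extWeight E r φ [u] * Real.log (extWeight E r φ [u]) := rfl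
  rw [hlog, h1]
  linarith

theorem log_descFactorial (m : ℕ) {k : ℕ} (hk : k ≤ m) :
    Real.log (m.descFactorial k) = ∑ j ∈ Finset.range k, Real.log ((m : ℝ) - j) := by
  induction k with
  | zero => simp
  | succ k ih =>
    have h1 : m - k ≠ 0 := by omega
    have h2 : m.descFactorial k ≠ 0 := by
      rw [Ne, Nat.descFactorial_eq_zero_iff_lt]; omega
    rw [Nat.descFactorial_succ, Finset.sum_range_succ, ← ih (by omega), Nat.cast_mul,
      Real.log_mul (by exact_mod_cast h1) (by exact_mod_cast h2), Nat.cast_sub (by omega)]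
    ring

/-- A spectral form of the Kruskal–Katona theorem: if the polynomial form of `E` takes a value `P`
at least that of the complete `r`-graph on `m` vertices, then `m * P ≤ r * |E|`. -/
theorem mul_le_card_of_choose_le {m : ℕ} (hr : 2 ≤ r) (hm : r ≤ m) (hE : ∀ e ∈ E, e.card = r)
    {x : V → ℝ} (hx : ∀ i, 0 ≤ x i) (hnorm : ∑ i, x i ^ r = 1)
    (hP : ((m - 1).choose (r - 1) : ℝ) ≤ r * ∑ e ∈ E, ∏ i ∈ e, x i) :
    m * (r * ∑ e ∈ E, ∏ i ∈ e, x i) ≤ r * E.card := by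
  set φ : Finset V → ℝ := fun e => ∏ i ∈ e, x i with hφdef
  set Q := ∑ e ∈ E, φ e with hQdef
  have hφ : ∀ e ∈ E, 0 ≤ φ e := fun e _ => Finset.prod_nonneg fun i _ => hx i
  have hchoose : (0 : ℝ) < (m - 1).choose (r - 1) := by
    exact_mod_cast Nat.choose_pos (by omega)
  have hrpos : (0 : ℝ) < r := by exact_mod_cast (by omega : 0 < r)
  have hQ : 0 < Q := by
    by_contra h
    have := mul_nonpos_of_nonneg_of_nonpos hrpos.le (not_lt.1 h)
    linarith
  have hcard : (0 : ℝ) < E.card := by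
    rcases E.eq_empty_or_nonempty with h | h
    · simp [hQdef, h] at hQ
    · exact_mod_cast h.card_pos
  set W : ℝ := r.factorial * Q with hW
  have hWpos : 0 < W := mul_pos (by positivity) hQ
  set S := tupleNegEntropy E r φ with hS
  have hS0 : S 0 = W * Real.log W := tupleNegEntropy_zero
  have hSr : W * Real.log (Q / E.card) ≤ S r := tupleNegEntropy_self_ge hE hφ hQ
  have hS1 : S r ≤ S 1 - W * Real.log W := tupleNegEntropy_self_le (by omega) hE hx hnorm hQ
  -- `u j` compares the entropy of vertex `j`, given the previous ones, with its value for `K_m^r`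
  set u : ℕ → ℝ := fun j => S j - S (j + 1) - W * Real.log ((m : ℝ) - j) with hu
  have hstep : ∀ j, j + 2 ≤ r → u j < 0 → u (j + 1) < 0 := by
    intro j hj hneg
    have ha : (2 : ℝ) ≤ (m : ℝ) - j := by
      have : ((j + 2 : ℕ) : ℝ) ≤ m := by exact_mod_cast hj.trans hm
      push_cast at this
      linarith
    set a : ℝ := (m : ℝ) - j with hadef
    have hp0 : 0 < (a - 1) / a := div_pos (by linarith) (by linarith)
    have hp1 : (a - 1) / a < 1 := (div_lt_one (by linarith)).2 (by linarith)
    have h := tupleNegEntropy_step hE hφ hj hp0 hp1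
    have h1 : 1 - (a - 1) / a = 1 / a := by field_simp; ring
    -- this choice of `p` makes the binary entropy term linear in the two logarithms
    have h2 : -((a - 1) / a * Real.log ((a - 1) / a)) -
        (1 - (a - 1) / a) * Real.log (1 - (a - 1) / a) =
        Real.log a - (a - 1) / a * Real.log (a - 1) := by
      rw [h1, Real.log_div (by linarith) (by linarith), Real.log_div one_ne_zero (by linarith),
        Real.log_one]
      field_simp
      ring
    rw [h2] at h
    have h3 : (a - 1) / a * u (j + 1) ≤ u j := by
      simp only [hu]
      have : (m : ℝ) - ((j + 1 : ℕ) : ℝ) = a - 1 := by push_cast; ring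
      rw [this, ← hadef]
      simp only [hS] at h ⊢
      linarith
    by_contra hcon
    have := mul_nonneg hp0.le (not_lt.1 hcon)
    linarith
  have htel : ∑ j ∈ Finset.range (r - 1), u (j + 1) =
      S 1 - S r - W * Real.log ((m - 1).descFactorial (r - 1)) := by
    rw [log_descFactorial _ (by omega), Finset.mul_sum]
    simp only [hu]
    rw [Finset.sum_sub_distrib]
    have h1 := Finset.sum_range_sub' (fun j => S (j + 1)) (r - 1)
    simp only [zero_add, show r - 1 + 1 = r by omega] at h1
    rw [h1]
    congr 1
    refine Finset.sum_congr rfl fun j _ => ?_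
    rw [Nat.cast_sub (by omega)]
    push_cast
    ring_nf
  have hWge : ((m - 1).descFactorial (r - 1) : ℝ) ≤ W := by
    rw [Nat.descFactorial_eq_factorial_mul_choose, hW,
      ← Nat.mul_factorial_pred (by omega : r ≠ 0)]
    push_cast
    nlinarith [mul_le_mul_of_nonneg_left hP (Nat.cast_nonneg (α := ℝ) (r - 1).factorial)]
  have hdpos : (0 : ℝ) < (m - 1).descFactorial (r - 1) := by
    exact_mod_cast Nat.pos_of_ne_zero fun h => by
      rw [Nat.descFactorial_eq_zero_iff_lt] at h; omega
  have hlogW : Real.log ((m - 1).descFactorial (r - 1)) ≤ Real.log W := Real.log_le_log hdpos hWge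
  have hsum : 0 ≤ ∑ j ∈ Finset.range (r - 1), u (j + 1) := by
    rw [htel]
    nlinarith
  have hu0 : 0 ≤ u 0 := by
    by_contra hneg
    have hall : ∀ j, j < r → u j < 0 := by
      intro j hj
      induction j with
      | zero => exact not_le.1 hneg
      | succ j ih => exact hstep j (by omega) (ih (by omega))
    have : ∑ j ∈ Finset.range (r - 1), u (j + 1) < 0 :=
      Finset.sum_neg (fun j hj => hall _ (by have := Finset.mem_range.1 hj; omega))
        ⟨0, Finset.mem_range.2 (by omega)⟩
    linarith
  have hmpos : (0 : ℝ) < m := by exact_mod_cast (by omega : 0 < m)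
  have h1 : Real.log m + Real.log (Q / E.card) ≤ 0 := by
    have h2 : W * (Real.log m + Real.log (Q / E.card)) ≤ 0 := by
      simp only [hu, zero_add, Nat.cast_zero, sub_zero] at hu0
      linarith
    by_contra hcon
    have := mul_pos hWpos (not_le.1 hcon)
    linarith
  rw [← Real.log_mul hmpos.ne' (by positivity), Real.log_nonpos_iff (by positivity)] at h1
  have h2 : (m : ℝ) * (Q / E.card) = m * Q / E.card := by ring
  rw [h2, div_le_one hcard] at h1
  nlinarith

end Spectral

theorem exists_nonneg_spectralRadius_le {V : Type*} [Fintype V] [Nonempty V] {r : ℕ} (hr : 1 ≤ r)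
    (H : RGraph V r) : ∃ x : V → ℝ, (∀ i, 0 ≤ x i) ∧ ∑ i, x i ^ r = 1 ∧
      H.spectralRadius ≤ r * ∑ e ∈ H.edges, ∏ i ∈ e, x i := by
  obtain ⟨x, hx, hmax⟩ := (isGreatest_spectralRadius hr H).1
  refine ⟨fun i => |x i|, fun i => abs_nonneg _, hx, ?_⟩
  rw [← hmax, polyForm]
  refine mul_le_mul_of_nonneg_left (Finset.sum_le_sum fun e _ => ?_) (Nat.cast_nonneg r)
  rw [← Finset.abs_prod]
  exact le_abs_self _

theorem mul_spectralRadius_le_card {V : Type*} [Fintype V] [Nonempty V] {r m : ℕ} (hr : 2 ≤ r)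
    (hm : r ≤ m) (H : RGraph V r) (h : ((m - 1).choose (r - 1) : ℝ) ≤ H.spectralRadius) :
    m * H.spectralRadius ≤ r * H.edges.card := by
  classical
  obtain ⟨x, hx, hnorm, hle⟩ := H.exists_nonneg_spectralRadius_le (by omega)
  refine le_trans (mul_le_mul_of_nonneg_left hle (Nat.cast_nonneg m)) ?_
  exact mul_le_card_of_choose_le hr hm H.uniform hx hnorm (h.trans hle)

theorem cast_mul_choose_pred {r m : ℕ} (hr : 1 ≤ r) (hm : 1 ≤ m) :
    (m : ℝ) * ((m - 1).choose (r - 1) : ℝ) = r * (m.choose r : ℝ) := by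
  obtain ⟨k, rfl⟩ : ∃ k, r = k + 1 := ⟨r - 1, by omega⟩
  obtain ⟨l, rfl⟩ : ∃ l, m = l + 1 := ⟨m - 1, by omega⟩
  have := Nat.add_one_mul_choose_eq l k
  rw [Nat.add_sub_cancel, Nat.add_sub_cancel]
  exact_mod_cast this.trans (mul_comm _ _)

theorem choose_le_card_of_le_spectralRadius {V : Type*} [Fintype V] [Nonempty V] {r m : ℕ}
    (hr : 2 ≤ r) (hm : r ≤ m) (H : RGraph V r)
    (h : ((m - 1).choose (r - 1) : ℝ) ≤ H.spectralRadius) : m.choose r ≤ H.edges.card := by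
  have h1 := mul_spectralRadius_le_card hr hm H h
  have h2 := mul_le_mul_of_nonneg_left h (Nat.cast_nonneg (α := ℝ) m)
  rw [cast_mul_choose_pred (by omega) (by omega)] at h2
  exact_mod_cast le_of_mul_le_mul_left (h2.trans h1) (by exact_mod_cast (by omega : 0 < r))

theorem choose_lt_card_of_lt_spectralRadius {V : Type*} [Fintype V] [Nonempty V] {r m : ℕ}
    (hr : 2 ≤ r) (hm : r ≤ m) (H : RGraph V r)
    (h : ((m - 1).choose (r - 1) : ℝ) < H.spectralRadius) : m.choose r < H.edges.card := by
  have h1 := mul_spectralRadius_le_card hr hm H h.le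
  have h2 := mul_lt_mul_of_pos_left h (show (0 : ℝ) < m by exact_mod_cast (by omega : 0 < m))
  rw [cast_mul_choose_pred (by omega) (by omega)] at h2
  exact_mod_cast lt_of_mul_lt_mul_left (h2.trans_le h1) (Nat.cast_nonneg r)

/-! ### Hamiltonian Berge cycles as periodic sequences -/

/-- A Hamiltonian Berge cycle on the vertex set `S` with edges in `E`, encoded by sequences
`c` of vertices and `ε` of edges of period `|S|` with `c i, c (i + 1) ∈ ε i`. -/
structure IsHamCycle {V : Type*} (E : Finset (Finset V)) (S : Finset V) (c : ℕ → V)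
    (ε : ℕ → Finset V) : Prop where
  vert_periodic : Function.Periodic c S.card
  edge_periodic : Function.Periodic ε S.card
  vert_mem : ∀ i, c i ∈ S
  edge_mem : ∀ i, ε i ∈ E
  vert_mem_edge : ∀ i, c i ∈ ε i
  vert_succ_mem_edge : ∀ i, c (i + 1) ∈ ε i
  vert_injOn : ∀ i j, i < S.card → j < S.card → c i = c j → i = j
  edge_injOn : ∀ i j, i < S.card → j < S.card → ε i = ε j → i = j

/-- A cycle can be given by its sequences on `[0, N)`, which are then extended periodically. -/
theorem exists_isHamCycle {V : Type*} {E : Finset (Finset V)} {S : Finset V} {c : ℕ → V}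
    {ε : ℕ → Finset V} {N : ℕ} (hS : S.card = N) (hN : 0 < N) (vert_mem : ∀ i < N, c i ∈ S)
    (edge_mem : ∀ i < N, ε i ∈ E) (vert_mem_edge : ∀ i < N, c i ∈ ε i)
    (vert_succ_mem_edge : ∀ i, i + 1 < N → c (i + 1) ∈ ε i) (hlast : c 0 ∈ ε (N - 1))
    (vert_injOn : ∀ i j, i < N → j < N → c i = c j → i = j)
    (edge_injOn : ∀ i j, i < N → j < N → ε i = ε j → i = j) :
    ∃ c' ε', IsHamCycle E S c' ε' := by
  have hmod : ∀ i, i % N < N := fun i => Nat.mod_lt i hN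
  refine ⟨fun i => c (i % N), fun i => ε (i % N), ?_, ?_, fun i => vert_mem _ (hmod i),
    fun i => edge_mem _ (hmod i), fun i => vert_mem_edge _ (hmod i), fun i => ?_, ?_, ?_⟩
  · intro i
    simp [hS]
  · intro i
    simp [hS]
  · by_cases h : i % N + 1 < N
    · have h1 : (i + 1) % N = i % N + 1 := by
        rw [Nat.add_mod_eq_add_mod_right 1 (Nat.mod_mod i N).symm, Nat.mod_eq_of_lt h]
      simpa only [h1] using vert_succ_mem_edge _ h
    · have h0 : i % N + 1 = N := by have := hmod i; omega
      have h1 : (i + 1) % N = 0 := by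
        rw [Nat.add_mod_eq_add_mod_right 1 (Nat.mod_mod i N).symm, h0, Nat.mod_self]
      have h2 : i % N = N - 1 := by omega
      simpa only [h1, h2] using hlast
  · intro i j hi hj h
    rw [hS] at hi hj
    rw [Nat.mod_eq_of_lt hi, Nat.mod_eq_of_lt hj] at h
    exact vert_injOn i j hi hj h
  · intro i j hi hj h
    rw [hS] at hi hj
    rw [Nat.mod_eq_of_lt hi, Nat.mod_eq_of_lt hj] at h
    exact edge_injOn i j hi hj h

/-- A sequence of period `N`, injective on `[0, N)`, is injective on every window of length `N`. -/
theorem eq_of_periodic_of_window {α : Type*} {f : ℕ → α} {N : ℕ} (hf : Function.Periodic f N)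
    (hinj : ∀ i j, i < N → j < N → f i = f j → i = j) {a b s : ℕ} (ha : s < a) (ha' : a ≤ s + N)
    (hb : s < b) (hb' : b ≤ s + N) (h : f a = f b) : a = b := by
  have hN : 0 < N := by omega
  have hmod : a % N = b % N := by
    rw [← hf.map_mod_nat a, ← hf.map_mod_nat b] at h
    exact hinj _ _ (Nat.mod_lt _ hN) (Nat.mod_lt _ hN) h
  rcases le_total a b with hab | hab
  · have := Nat.eq_zero_of_dvd_of_lt ((Nat.modEq_iff_dvd' hab).1 hmod) (by omega)
    omega
  · have := Nat.eq_zero_of_dvd_of_lt ((Nat.modEq_iff_dvd' hab).1 hmod.symm) (by omega)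
    omega

theorem exists_vert_of_injOn {V : Type*} [DecidableEq V] {S : Finset V} {c : ℕ → V}
    (hc : ∀ i, c i ∈ S) (hinj : ∀ i j, i < S.card → j < S.card → c i = c j → i = j) {v : V}
    (hv : v ∈ S) : ∃ i < S.card, c i = v := by
  have : (Finset.range S.card).image c = S := by
    refine Finset.eq_of_subset_of_card_le ?_ (le_of_eq ?_)
    · intro w hw
      obtain ⟨i, -, rfl⟩ := Finset.mem_image.1 hw
      exact hc i
    · rw [Finset.card_image_of_injOn, Finset.card_range]
      intro i hi j hj hij
      exact hinj i j (by simpa using hi) (by simpa using hj) hij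
  rw [← this] at hv
  simpa using hv

namespace IsHamCycle

variable {V : Type*} {E : Finset (Finset V)} {S : Finset V} {c : ℕ → V} {ε : ℕ → Finset V}

theorem vert_inj_window (h : IsHamCycle E S c ε) {a b s : ℕ} (ha : s < a) (ha' : a ≤ s + S.card)
    (hb : s < b) (hb' : b ≤ s + S.card) (hab : c a = c b) : a = b :=
  eq_of_periodic_of_window h.vert_periodic h.vert_injOn ha ha' hb hb' hab

theorem edge_inj_window (h : IsHamCycle E S c ε) {a b s : ℕ} (ha : s < a) (ha' : a ≤ s + S.card)
    (hb : s < b) (hb' : b ≤ s + S.card) (hab : ε a = ε b) : a = b :=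
  eq_of_periodic_of_window h.edge_periodic h.edge_injOn ha ha' hb hb' hab

theorem exists_vert_eq (h : IsHamCycle E S c ε) {v : V} (hv : v ∈ S) : ∃ i < S.card, c i = v := by
  classical
  exact exists_vert_of_injOn h.vert_mem h.vert_injOn hv

theorem card_pos (h : IsHamCycle E S c ε) : 0 < S.card := Finset.card_pos.2 ⟨_, h.vert_mem 0⟩

theorem hasHamiltonianBergeCycle [Fintype V] {r : ℕ} {H : RGraph V r}
    (h : IsHamCycle H.edges Finset.univ c ε) : H.HasHamiltonianBergeCycle := by
  have hpos := h.card_pos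
  obtain ⟨k, hk⟩ : ∃ k, (Finset.univ : Finset V).card = k + 1 := ⟨_, (Nat.succ_pred hpos.ne').symm⟩
  have hvp := h.vert_periodic
  have hep := h.edge_periodic
  rw [hk] at hvp hep
  refine ⟨k + 1, ⟨fun i => c (i + 1), fun i => ε i, ?_, ?_, fun i => h.edge_mem _,
    fun i => h.vert_succ_mem_edge _, fun i => ?_⟩, ?_⟩
  · intro i j hij
    have := h.vert_inj_window (s := 0) (by omega) (by have := i.2; omega) (by omega)
      (by have := j.2; omega) hij
    exact Fin.ext (by omega)
  · intro i j hij
    exact Fin.ext (h.edge_injOn i j (by have := i.2; omega) (by have := j.2; omega) hij)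
  · have h1 : ε (finRotate (k + 1) i : Fin (k + 1)) = ε (i + 1) := by
      rw [finRotate_apply, ← hep.map_mod_nat (i + 1), Fin.val_add, Fin.val_one']
      congr 1
      simp
    rw [h1]
    exact h.vert_mem_edge _
  · intro v
    obtain ⟨i, hi, rfl⟩ := h.exists_vert_eq (Finset.mem_univ v)
    rcases i with _ | i
    · refine ⟨⟨k, by omega⟩, ?_⟩
      have := hvp 0
      rw [zero_add] at this
      exact this
    · exact ⟨⟨i, by omega⟩, rfl⟩

/-- Leaving out one edge of a Hamiltonian Berge cycle gives a Hamiltonian Berge path. -/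
theorem hasHamiltonianBergePath [Fintype V] [DecidableEq V] {r : ℕ} {H : RGraph V r} {f : Finset V}
    (h : IsHamCycle (insert f H.edges) Finset.univ c ε) : H.HasHamiltonianBergePath := by
  have hpos := h.card_pos
  obtain ⟨k, hk⟩ : ∃ k, (Finset.univ : Finset V).card = k + 1 := ⟨_, (Nat.succ_pred hpos.ne').symm⟩
  obtain ⟨s, hs⟩ : ∃ s, ∀ i, i < k → ε (s + 1 + i) ∈ H.edges := by
    by_cases hf : ∃ s, ε s = f
    · obtain ⟨s, hs⟩ := hf
      refine ⟨s, fun i hi => (Finset.mem_insert.1 (h.edge_mem (s + 1 + i))).resolve_left ?_⟩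
      rw [← hs, ← h.edge_periodic s]
      intro hcon
      have := h.edge_inj_window (s := s) (by omega) (by omega) (by omega) (by omega) hcon
      omega
    · exact ⟨0, fun i _ => (Finset.mem_insert.1 (h.edge_mem _)).resolve_left fun hcon => hf ⟨_, hcon⟩⟩
  refine ⟨k, ⟨fun i => c (s + 1 + i), fun i => ε (s + 1 + i), ?_, ?_, fun i => hs i i.2,
    fun i => h.vert_mem_edge _, fun i => h.vert_succ_mem_edge _⟩, ?_⟩
  · intro i j hij
    have := h.vert_inj_window (s := s) (by omega) (by have := i.2; omega) (by omega)
      (by have := j.2; omega) hij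
    exact Fin.ext (by omega)
  · intro i j hij
    have := h.edge_inj_window (s := s) (by omega) (by have := i.2; omega) (by omega)
      (by have := j.2; omega) hij
    exact Fin.ext (by omega)
  · refine ((Fintype.bijective_iff_injective_and_card _).2 ⟨?_, ?_⟩).2
    · intro i j hij
      have := h.vert_inj_window (s := s) (by omega) (by have := i.2; omega) (by omega)
        (by have := j.2; omega) hij
      exact Fin.ext (by omega)
    · rw [Fintype.card_fin, ← hk, Finset.card_univ]

variable [DecidableEq V] {v : V} {F G : Finset V} {i j : ℕ}

/-- A new vertex `v` can be inserted between `c i` and `c (i + 1)`. -/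
theorem insert_vertex (h : IsHamCycle (E.filter (v ∉ ·)) S c ε) (hv : v ∉ S) (hF : F ∈ E)
    (hG : G ∈ E) (hvF : v ∈ F) (hvG : v ∈ G) (hFG : F ≠ G) (hi : c i ∈ F) (hj : c (i + 1) ∈ G) :
    ∃ c' ε', IsHamCycle E (insert v S) c' ε' := by
  have hpos := h.card_pos
  set N := S.card with hN
  have hE : ∀ k, ε k ∈ E ∧ v ∉ ε k := fun k => Finset.mem_filter.1 (h.edge_mem k)
  have hcv : ∀ k, c k ≠ v := fun k hk => hv (hk ▸ h.vert_mem k)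
  have hlast : c (i + N) = c i := h.vert_periodic i
  have hεF : ∀ k, ε k ≠ F := fun k hk => (hE k).2 (hk ▸ hvF)
  have hεG : ∀ k, ε k ≠ G := fun k hk => (hE k).2 (hk ▸ hvG)
  have hc := fun a b h1 h2 h3 h4 => h.vert_inj_window (a := a) (b := b) (s := i) h1 h2 h3 h4
  have he := fun a b h1 h2 h3 h4 => h.edge_inj_window (a := a) (b := b) (s := i) h1 h2 h3 h4
  refine exists_isHamCycle (N := N + 1) (c := fun k => if k = 0 then v else c (i + k))
    (ε := fun k => if k = 0 then G else if k = N then F else ε (i + k))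
    (by rw [Finset.card_insert_of_notMem hv]) (by omega) ?_ ?_ ?_ ?_ ?_ ?_ ?_
  · intro k _
    split_ifs
    · exact Finset.mem_insert_self _ _
    · exact Finset.mem_insert_of_mem (h.vert_mem _)
  · intro k _
    split_ifs
    exacts [hG, hF, (hE _).1]
  · intro k _
    split_ifs with h1 h2
    · exact hvG
    · rw [h2, hlast]; exact hi
    · exact h.vert_mem_edge _
  · intro k hk
    rw [if_neg k.succ_ne_zero, if_neg (show k ≠ N by omega)]
    split_ifs with h1
    · rw [h1]; exact hj
    · exact h.vert_succ_mem_edge _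
  · simpa [hpos.ne'] using hvF
  · intro a b ha hb hab
    split_ifs at hab with h1 h2 h2
    · omega
    · exact absurd hab.symm (hcv _)
    · exact absurd hab (hcv _)
    · have := hc _ _ (by omega) (by omega) (by omega) (by omega) hab
      omega
  · intro a b ha hb hab
    split_ifs at hab with h1 h2 h3 h4 h5 h6 h7 h8
    · omega
    · exact absurd hab.symm hFG
    · exact absurd hab.symm (hεG _)
    · exact absurd hab hFG
    · omega
    · exact absurd hab.symm (hεF _)
    · exact absurd hab (hεG _)
    · exact absurd hab (hεF _)
    · have := he _ _ (by omega) (by omega) (by omega) (by omega) hab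
      omega

/-- A new vertex `v` can be inserted between `c i` and `c j` by reversing the segment
`c (i + 1), …, c j`, if some edge joins `c (i + 1)` to `c (j + 1)`. -/
theorem cross_vertex_of_lt (h : IsHamCycle (E.filter (v ∉ ·)) S c ε) (hv : v ∉ S) (hF : F ∈ E)
    (hG : G ∈ E) (hvF : v ∈ F) (hvG : v ∈ G) (hFG : F ≠ G) (hij : i < j) (hjN : j < S.card)
    (hi : c i ∈ F) (hj : c j ∈ G) {f : Finset V} (hf : f ∈ E) (hvf : v ∉ f)
    (hfi : c (i + 1) ∈ f) (hfj : c (j + 1) ∈ f)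
    (hfε : ∀ k < S.card, k ≠ i → k ≠ j → ε k ≠ f) :
    ∃ c' ε', IsHamCycle E (insert v S) c' ε' := by
  have hpos := h.card_pos
  set N := S.card with hN
  have hE : ∀ k, ε k ∈ E ∧ v ∉ ε k := fun k => Finset.mem_filter.1 (h.edge_mem k)
  have hcv : ∀ k, c k ≠ v := fun k hk => hv (hk ▸ h.vert_mem k)
  have hlast : c (i + N) = c i := h.vert_periodic i
  have hεF : ∀ k, ε k ≠ F := fun k hk => (hE k).2 (hk ▸ hvF)
  have hεG : ∀ k, ε k ≠ G := fun k hk => (hE k).2 (hk ▸ hvG)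
  have hfF : f ≠ F := fun hk => hvf (hk ▸ hvF)
  have hfG : f ≠ G := fun hk => hvf (hk ▸ hvG)
  have hfε' : ∀ k, i < k → k < i + N → k ≠ j → ε k ≠ f := by
    intro k hk1 hk2 hkj
    by_cases hkN : k < N
    · exact hfε k hkN (by omega) hkj
    · have := h.edge_periodic (k - N)
      rw [← hN, Nat.sub_add_cancel (by omega)] at this
      rw [this]
      exact hfε _ (by omega) (by omega) (by omega)
  have hc := fun a b h1 h2 h3 h4 => h.vert_inj_window (a := a) (b := b) (s := i) h1 h2 h3 h4
  have he := fun a b h1 h2 h3 h4 => h.edge_inj_window (a := a) (b := b) (s := i) h1 h2 h3 h4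
  refine exists_isHamCycle (N := N + 1)
    (c := fun k => if k = 0 then v else c (if k ≤ j - i then j + 1 - k else i + k))
    (ε := fun k => if k = 0 then G else if k = N then F else if k = j - i then f else
      ε (if k < j - i then j - k else i + k))
    (by rw [Finset.card_insert_of_notMem hv]) (by omega) ?_ ?_ ?_ ?_ ?_ ?_ ?_
  · intro k _
    split_ifs
    · exact Finset.mem_insert_self _ _
    · exact Finset.mem_insert_of_mem (h.vert_mem _)
    · exact Finset.mem_insert_of_mem (h.vert_mem _)
  · intro k _
    split_ifs
    exacts [hG, hF, hf, (hE _).1, (hE _).1]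
  · intro k hk
    rcases Nat.eq_zero_or_pos k with h0 | h0
    · simpa [h0] using hvG
    by_cases hkN : k = N
    · subst hkN
      simpa [h0.ne', show ¬ N ≤ j - i by omega, hlast] using hi
    rcases lt_trichotomy k (j - i) with h1 | h1 | h1
    · have := h.vert_succ_mem_edge (j - k)
      rw [show j - k + 1 = j + 1 - k by omega] at this
      simpa [h0.ne', hkN, h1.le, h1, h1.ne] using this
    · have h2 : j + 1 - k = i + 1 := by omega
      simpa [h0.ne', hkN, h1.le, h1.symm, h2] using hfi
    · have h2 := h.vert_mem_edge (i + k)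
      simpa [h0.ne', hkN, h1.not_ge, h1.ne', h1.not_gt] using h2
  · intro k hk
    have hkN : k ≠ N := by omega
    rcases Nat.eq_zero_or_pos k with h0 | h0
    · simpa [h0, show 1 ≤ j - i by omega] using hj
    rcases lt_trichotomy k (j - i) with h1 | h1 | h1
    · have h2 := h.vert_mem_edge (j - k)
      rw [← show j + 1 - (k + 1) = j - k by omega] at h2
      simpa [h0.ne', hkN, show k + 1 ≤ j - i by omega, h1, h1.ne] using h2
    · have h2 : i + (k + 1) = j + 1 := by omega
      simpa [h0.ne', hkN, show ¬ k + 1 ≤ j - i by omega, h1.symm, h2] using hfj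
    · have h2 := h.vert_succ_mem_edge (i + k)
      simpa [h0.ne', hkN, show ¬ k + 1 ≤ j - i by omega, h1.ne', h1.not_gt, add_assoc] using h2
  · simpa [hpos.ne'] using hvF
  · intro a b ha hb hab
    split_ifs at hab with h1 h2 h2
    all_goals first
      | omega
      | exact absurd hab.symm (hcv _)
      | exact absurd hab (hcv _)
      | (have := hc _ _ (by omega) (by omega) (by omega) (by omega) hab
         omega)
  · intro a b ha hb hab
    split_ifs at hab
    all_goals first
      | omega
      | exact absurd hab hFG
      | exact absurd hab.symm hFG
      | exact absurd hab (hεF _)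
      | exact absurd hab.symm (hεF _)
      | exact absurd hab (hεG _)
      | exact absurd hab.symm (hεG _)
      | exact absurd hab hfF
      | exact absurd hab.symm hfF
      | exact absurd hab hfG
      | exact absurd hab.symm hfG
      | exact absurd hab (hfε' _ (by omega) (by omega) (by omega))
      | exact absurd hab.symm (hfε' _ (by omega) (by omega) (by omega))
      | (have := he _ _ (by omega) (by omega) (by omega) (by omega) hab
         omega)

theorem cross_vertex (h : IsHamCycle (E.filter (v ∉ ·)) S c ε) (hv : v ∉ S) (hF : F ∈ E)
    (hG : G ∈ E) (hvF : v ∈ F) (hvG : v ∈ G) (hFG : F ≠ G) (hij : i ≠ j) (hiN : i < S.card)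
    (hjN : j < S.card) (hi : c i ∈ F) (hj : c j ∈ G) {f : Finset V} (hf : f ∈ E) (hvf : v ∉ f)
    (hfi : c (i + 1) ∈ f) (hfj : c (j + 1) ∈ f)
    (hfε : ∀ k < S.card, k ≠ i → k ≠ j → ε k ≠ f) :
    ∃ c' ε', IsHamCycle E (insert v S) c' ε' := by
  rcases lt_or_gt_of_ne hij with hlt | hlt
  · exact h.cross_vertex_of_lt hv hF hG hvF hvG hFG hlt hjN hi hj hf hvf hfi hfj hfε
  · exact h.cross_vertex_of_lt hv hG hF hvG hvF hFG.symm hlt hiN hj hi hf hvf hfj hfi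
      fun k hk h1 h2 => hfε k hk h2 h1

end IsHamCycle

/-! ### Counting families of sets -/

theorem le_choose_self {M k : ℕ} (hk : 1 ≤ k) (hkM : k + 1 ≤ M) : M ≤ M.choose k := by
  induction M generalizing k with
  | zero => omega
  | succ M ih =>
    obtain ⟨l, rfl⟩ : ∃ l, k = l + 1 := ⟨k - 1, by omega⟩
    rw [Nat.choose_succ_succ']
    rcases (show l + 1 ≤ M by omega).eq_or_lt with h | h
    · have h1 : M.choose l = M := by
        rw [← h, Nat.choose_succ_self_right]
      have h2 : 0 < M.choose (l + 1) := Nat.choose_pos h.le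
      omega
    · have := ih (k := l + 1) (by omega) (by omega)
      have h2 : 0 < M.choose l := Nat.choose_pos (by omega)
      omega

section families

variable {V : Type*} [DecidableEq V]

/-- The sets `P ∪ g` with `g` a `k`-element subset of `T`. -/
def extFamily (P T : Finset V) (k : ℕ) : Finset (Finset V) :=
  (T.powersetCard k).image (P ∪ ·)

theorem card_extFamily {P T : Finset V} (h : Disjoint P T) (k : ℕ) :
    (extFamily P T k).card = T.card.choose k := by
  rw [extFamily, Finset.card_image_of_injOn, Finset.card_powersetCard]
  intro g hg g' hg' heq
  have hg := (Finset.mem_powersetCard.1 hg).1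
  have hg' := (Finset.mem_powersetCard.1 hg').1
  have h1 : ∀ g, g ⊆ T → (P ∪ g) \ P = g := fun g hg => by
    rw [Finset.union_sdiff_left]
    exact Finset.sdiff_eq_self_of_disjoint (Disjoint.mono_left hg h.symm)
  rw [← h1 g hg, ← h1 g' hg']
  exact congrArg (· \ P) heq

theorem mem_extFamily {P T f : Finset V} {k : ℕ} :
    f ∈ extFamily P T k ↔ ∃ g ⊆ T, g.card = k ∧ P ∪ g = f := by
  simp [extFamily, Finset.mem_powersetCard, and_assoc]

theorem extFamily_subset {P T S : Finset V} {k r : ℕ} (h : Disjoint P T) (hP : P ⊆ S) (hT : T ⊆ S)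
    (hr : P.card + k = r) : extFamily P T k ⊆ S.powersetCard r := by
  intro f hf
  obtain ⟨g, hg, hgk, rfl⟩ := mem_extFamily.1 hf
  rw [Finset.mem_powersetCard]
  exact ⟨Finset.union_subset hP (hg.trans hT),
    by rw [Finset.card_union_of_disjoint (h.mono_right hg), hgk, hr]⟩

/-- Many `r`-subsets of `S` contain `y` and one of `z`, `z'`. -/
theorem card_filter_mem_and_mem_or_mem_ge {S : Finset V} {y z z' : V} {r : ℕ} (hy : y ∈ S)
    (hz : z ∈ S) (hz' : z' ∈ S) (hyz : y ≠ z) (hyz' : y ≠ z') (hzz' : z ≠ z') (hr : 2 ≤ r) :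
    (S.card - 2).choose (r - 2) + (S.card - 3).choose (r - 2) ≤
      ((S.powersetCard r).filter fun f => y ∈ f ∧ (z ∈ f ∨ z' ∈ f)).card := by
  have hd1 : Disjoint ({y, z} : Finset V) (S \ {y, z}) := Finset.disjoint_sdiff
  have hd2 : Disjoint ({y, z'} : Finset V) (S \ {y, z, z'}) := by
    refine Finset.disjoint_sdiff.mono_left ?_
    intro a
    simp only [Finset.mem_insert, Finset.mem_singleton]
    tauto
  have hs1 : ({y, z} : Finset V) ⊆ S := by simp [Finset.insert_subset_iff, hy, hz]
  have hs2 : ({y, z'} : Finset V) ⊆ S := by simp [Finset.insert_subset_iff, hy, hz']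
  have hs3 : ({y, z, z'} : Finset V) ⊆ S := by simp [Finset.insert_subset_iff, hy, hz, hz']
  have hc1 : ({y, z} : Finset V).card = 2 := Finset.card_pair hyz
  have hc2 : ({y, z'} : Finset V).card = 2 := Finset.card_pair hyz'
  have hc3 : ({y, z, z'} : Finset V).card = 3 := Finset.card_eq_three.2 ⟨y, z, z', hyz, hyz', hzz', rfl⟩
  have hdisj : Disjoint (extFamily {y, z} (S \ {y, z}) (r - 2))
      (extFamily {y, z'} (S \ {y, z, z'}) (r - 2)) := by
    rw [Finset.disjoint_left]
    intro f hf hf'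
    obtain ⟨g, -, -, rfl⟩ := mem_extFamily.1 hf
    obtain ⟨g', hg', -, heq⟩ := mem_extFamily.1 hf'
    have h1 : z ∈ {y, z'} ∪ g' := heq ▸ Finset.mem_union_left _ (by simp)
    rcases Finset.mem_union.1 h1 with h1 | h1
    · simp [hyz.symm, hzz'] at h1
    · simpa using hg' h1
  calc (S.card - 2).choose (r - 2) + (S.card - 3).choose (r - 2)
      = (extFamily {y, z} (S \ {y, z}) (r - 2) ∪
          extFamily {y, z'} (S \ {y, z, z'}) (r - 2)).card := by
        rw [Finset.card_union_of_disjoint hdisj, card_extFamily hd1, card_extFamily hd2,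
          Finset.card_sdiff_of_subset hs1, Finset.card_sdiff_of_subset hs3, hc1, hc3]
    _ ≤ _ := by
        refine Finset.card_le_card fun f hf => Finset.mem_filter.2 ?_
        rcases Finset.mem_union.1 hf with hf | hf
        · refine ⟨extFamily_subset hd1 hs1 Finset.sdiff_subset (by omega) hf, ?_⟩
          obtain ⟨g, -, -, rfl⟩ := mem_extFamily.1 hf
          simp
        · refine ⟨extFamily_subset hd2 hs2 Finset.sdiff_subset (by omega) hf, ?_⟩
          obtain ⟨g, -, -, rfl⟩ := mem_extFamily.1 hf
          simp

/-- The `r`-subsets of `S` meeting `A` in exactly two elements. -/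
def pairFamily (S A : Finset V) (r : ℕ) : Finset (Finset V) :=
  (A.powersetCard 2).biUnion fun P => extFamily P (S \ A) (r - 2)

theorem card_pairFamily (S A : Finset V) (hA : A ⊆ S) (r : ℕ) :
    (pairFamily S A r).card = A.card.choose 2 * (S.card - A.card).choose (r - 2) := by
  have hdis : ∀ P ∈ A.powersetCard 2, Disjoint P (S \ A) := fun P hP =>
    Finset.disjoint_sdiff.mono_left (Finset.mem_powersetCard.1 hP).1
  rw [pairFamily, Finset.card_biUnion]
  · rw [Finset.sum_congr rfl fun P hP => card_extFamily (hdis P hP) _, Finset.sum_const,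
      Finset.card_powersetCard, smul_eq_mul, Finset.card_sdiff_of_subset hA]
  · intro P hP P' hP' hne
    rw [Function.onFun, Finset.disjoint_left]
    intro f hf hf'
    obtain ⟨g, hg, -, rfl⟩ := mem_extFamily.1 hf
    obtain ⟨g', hg', -, heq⟩ := mem_extFamily.1 hf'
    have h1 : ∀ Q ∈ A.powersetCard 2, ∀ g ⊆ S \ A, (Q ∪ g) ∩ A = Q := by
      intro Q hQ g hg
      have h2 : g ∩ A = ∅ := Finset.disjoint_iff_inter_eq_empty.1
        (Finset.sdiff_disjoint.mono_left hg)
      rw [Finset.union_inter_distrib_right, h2, Finset.union_empty]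
      exact Finset.inter_eq_left.2 (Finset.mem_powersetCard.1 hQ).1
    exact hne (by rw [← h1 P hP g hg, ← h1 P' hP' g' hg', heq])

theorem mem_pairFamily {S A : Finset V} (hA : A ⊆ S) {r : ℕ} (hr : 2 ≤ r) {f : Finset V}
    (hf : f ∈ pairFamily S A r) :
    f ∈ S.powersetCard r ∧ ∃ a ∈ A, ∃ b ∈ A, a ≠ b ∧ a ∈ f ∧ b ∈ f := by
  obtain ⟨P, hP, hfP⟩ := Finset.mem_biUnion.1 hf
  have hP' := Finset.mem_powersetCard.1 hP
  refine ⟨extFamily_subset (Finset.disjoint_sdiff.mono_left hP'.1) (hP'.1.trans hA)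
    Finset.sdiff_subset (by omega) hfP, ?_⟩
  obtain ⟨g, -, -, rfl⟩ := mem_extFamily.1 hfP
  obtain ⟨a, b, hab, rfl⟩ := Finset.card_eq_two.1 hP'.2
  exact ⟨a, hP'.1 (by simp), b, hP'.1 (by simp), hab, by simp, by simp⟩

/-- Disjointness of `Y` from the cyclic shift of `X`. -/
theorem card_add_card_le_of_succ_notMem {N : ℕ} (hN : 0 < N) {X Y : Finset ℕ}
    (hX : X ⊆ Finset.range N) (hY : Y ⊆ Finset.range N)
    (h : ∀ i ∈ X, (i + 1) % N ∉ Y) : X.card + Y.card ≤ N := by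
  have hinj : Set.InjOn (fun i => (i + 1) % N) X := by
    intro i hi j hj hij
    have hi := Finset.mem_range.1 (hX hi)
    have hj := Finset.mem_range.1 (hX hj)
    exact Nat.ModEq.eq_of_lt_of_lt (Nat.ModEq.add_right_cancel' 1 hij) hi hj
  rw [← Finset.card_image_of_injOn hinj, ← Finset.card_union_of_disjoint]
  · refine (Finset.card_le_card (Finset.union_subset ?_ hY)).trans (Finset.card_range N).le
    intro a ha
    obtain ⟨i, -, rfl⟩ := Finset.mem_image.1 ha
    exact Finset.mem_range.2 (Nat.mod_lt _ hN)
  · rw [Finset.disjoint_left]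
    intro a ha
    obtain ⟨i, hi, rfl⟩ := Finset.mem_image.1 ha
    exact h i hi

/-- The size `C(s, 2) * C(d, r - 2)` of `pairFamily` exceeds the number of sets that can be missing or
lie on the cycle. -/
theorem choose_two_mul_choose_gt {s d r : ℕ} (hs : 3 ≤ s) (hsd : s ≤ d) (hr : 3 ≤ r)
    (hrd : r ≤ d + 1) : s.choose (r - 1) + (s + d) < s.choose 2 * d.choose (r - 2) + 1 := by
  obtain ⟨k, rfl⟩ : ∃ k, r = k + 3 := ⟨r - 3, by omega⟩
  simp only [show k + 3 - 1 = k + 2 by omega, show k + 3 - 2 = k + 1 by omega]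
  have h1 := Nat.choose_succ_right_eq s (k + 1)
  have h2 : s.choose (k + 1) ≤ d.choose (k + 1) := Nat.choose_le_choose _ hsd
  have h3 : d ≤ d.choose (k + 1) := le_choose_self (by omega) (by omega)
  have h4 : s.choose 2 * 2 = s * (s - 1) := by
    have := Nat.choose_succ_right_eq s 1
    simpa using this
  obtain ⟨t, rfl⟩ : ∃ t, s = t + 3 := ⟨s - 3, by omega⟩
  set X := d.choose (k + 1)
  have h5 : 2 * (t + 3).choose (k + 2) ≤ (t + 2) * X := by
    calc 2 * (t + 3).choose (k + 2) ≤ (t + 3).choose (k + 1 + 1) * (k + 1 + 1) := by nlinarith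
      _ = (t + 3).choose (k + 1) * (t + 3 - (k + 1)) := h1
      _ ≤ X * (t + 2) := Nat.mul_le_mul h2 (by omega)
      _ = _ := mul_comm _ _
  have h6 : (t + 3).choose 2 * X * 2 = (t + 3) * (t + 2) * X := by
    rw [mul_right_comm, h4]; simp
  nlinarith

end families

/-! ### Inserting a vertex into a Hamiltonian Berge cycle -/

/-- Two positions `i ≠ j` of a cycle are `v`-linked if distinct edges at `v` contain
`c i` and `c j`. -/
def Linked {V : Type*} (E : Finset (Finset V)) (v : V) (c : ℕ → V) (i j : ℕ) : Prop :=
  i ≠ j ∧ ∃ F ∈ E, ∃ G ∈ E, v ∈ F ∧ v ∈ G ∧ F ≠ G ∧ c i ∈ F ∧ c j ∈ G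

theorem Linked.symm {V : Type*} {E : Finset (Finset V)} {v : V} {c : ℕ → V} {i j : ℕ}
    (h : Linked E v c i j) : Linked E v c j i := by
  obtain ⟨hij, F, hF, G, hG, hvF, hvG, hFG, hi, hj⟩ := h
  exact ⟨hij.symm, G, hG, F, hF, hvG, hvF, hFG.symm, hj, hi⟩

section insertion

variable {V : Type*} [DecidableEq V] {E : Finset (Finset V)} {S : Finset V} {v : V}
  {c : ℕ → V} {ε : ℕ → Finset V}

/-- If `v` cannot be inserted into the cycle, then few `r`-sets contain the successors of two linked
positions: such a set is missing from `E`, or it is an edge of the cycle that does not start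
in `A`. -/
theorem card_add_card_le_of_linked {r : ℕ} (h : IsHamCycle (E.filter (v ∉ ·)) S c ε) (hv : v ∉ S)
    (hE : ∀ e ∈ E, e ⊆ insert v S ∧ e.card = r) (hcard : S.card.choose r + 1 ≤ E.card)
    (hno : ¬ ∃ c' ε', IsHamCycle E (insert v S) c' ε')
    {A : Finset ℕ} (hA : A ⊆ Finset.range S.card) {𝒯 : Finset (Finset V)}
    (h𝒯 : 𝒯 ⊆ S.powersetCard r)
    (hlink : ∀ f ∈ 𝒯, ∃ a ∈ A, ∃ b ∈ A, Linked E v c a b ∧ c (a + 1) ∈ f ∧ c (b + 1) ∈ f)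
    (hclosed : ∀ f ∈ 𝒯, ∀ a ∈ A, c (a + 1) ∈ f → ∃ b ∈ A, Linked E v c a b ∧ c (b + 1) ∈ f) :
    𝒯.card + 1 + A.card ≤ (E.filter (v ∈ ·)).card + S.card := by
  have hvf : ∀ f ∈ 𝒯, v ∉ f := fun f hf hvf => hv ((Finset.mem_powersetCard.1 (h𝒯 hf)).1 hvf)
  -- an edge containing the successors of two linked positions lies on the cycle
  have hblock : ∀ f ∈ 𝒯, f ∈ E → ∀ a ∈ A, ∀ b ∈ A, Linked E v c a b → c (a + 1) ∈ f →
      c (b + 1) ∈ f → ∃ k < S.card, k ≠ a ∧ k ≠ b ∧ ε k = f := by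
    intro f hf hfE a ha b hb hab haf hbf
    by_contra hcon
    push Not at hcon
    obtain ⟨hab, F, hF, G, hG, hvF, hvG, hFG, hi, hj⟩ := hab
    exact hno (h.cross_vertex hv hF hG hvF hvG hFG hab (Finset.mem_range.1 (hA ha))
      (Finset.mem_range.1 (hA hb)) hi hj hfE (hvf f hf) haf hbf hcon)
  have h1 : 𝒯.filter (· ∈ E) ⊆ (Finset.range S.card \ A).image ε := by
    intro f hf
    obtain ⟨hf, hfE⟩ := Finset.mem_filter.1 hf
    obtain ⟨a, ha, b, hb, hab, haf, hbf⟩ := hlink f hf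
    obtain ⟨k, hk, -, -, hkf⟩ := hblock f hf hfE a ha b hb hab haf hbf
    refine Finset.mem_image.2 ⟨k, Finset.mem_sdiff.2 ⟨Finset.mem_range.2 hk, fun hkA => ?_⟩, hkf⟩
    obtain ⟨b', hb', hkb, hbf'⟩ := hclosed f hf k hkA (hkf ▸ h.vert_succ_mem_edge k)
    obtain ⟨k', hk', hne, -, hkf'⟩ :=
      hblock f hf hfE k hkA b' hb' hkb (hkf ▸ h.vert_succ_mem_edge k) hbf'
    exact hne (h.edge_injOn k' k hk' hk (hkf'.trans hkf.symm))
  have h2 : (𝒯.filter (· ∈ E)).card + A.card ≤ S.card := by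
    have h3 := (Finset.card_le_card h1).trans Finset.card_image_le
    have h4 := Finset.card_le_card hA
    rw [Finset.card_sdiff_of_subset hA, Finset.card_range] at h3
    rw [Finset.card_range] at h4
    omega
  have h5 : (𝒯.filter (· ∉ E)).card + (E.filter (v ∉ ·)).card ≤ S.card.choose r := by
    rw [← Finset.card_powersetCard, ← Finset.card_union_of_disjoint]
    · refine Finset.card_le_card (Finset.union_subset ((Finset.filter_subset _ _).trans h𝒯) ?_)
      intro e he
      obtain ⟨he, hve⟩ := Finset.mem_filter.1 he
      refine Finset.mem_powersetCard.2 ⟨?_, (hE e he).2⟩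
      exact (Finset.subset_insert_iff_of_notMem hve).1 (hE e he).1
    · rw [Finset.disjoint_left]
      intro e he he'
      exact (Finset.mem_filter.1 he).2 (Finset.mem_filter.1 he').1
  have h6 := Finset.card_filter_add_card_filter_not (s := 𝒯) (· ∈ E)
  have h7 := Finset.card_filter_add_card_filter_not (s := E) (v ∈ ·)
  omega

/-- The positions of the vertices of `F` on the cycle. -/
def positions (c : ℕ → V) (N : ℕ) (F : Finset V) : Finset ℕ :=
  (Finset.range N).filter (c · ∈ F)

theorem mem_positions {N i : ℕ} {F : Finset V} : i ∈ positions c N F ↔ i < N ∧ c i ∈ F := by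
  simp [positions]

theorem image_positions {E' : Finset (Finset V)} (h : IsHamCycle E' S c ε) {F : Finset V}
    (hF : F ⊆ insert v S) (hv : v ∉ S) :
    (positions c S.card F).image c = F.erase v := by
  ext w
  simp only [Finset.mem_image, mem_positions, Finset.mem_erase]
  constructor
  · rintro ⟨i, ⟨-, hi⟩, rfl⟩
    exact ⟨fun heq => hv (heq ▸ h.vert_mem i), hi⟩
  · rintro ⟨hwv, hw⟩
    obtain ⟨i, hi, rfl⟩ := h.exists_vert_eq ((Finset.mem_insert.1 (hF hw)).resolve_left hwv)
    exact ⟨i, ⟨hi, hw⟩, rfl⟩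

theorem card_positions {E' : Finset (Finset V)} (h : IsHamCycle E' S c ε) {F : Finset V}
    (hvF : v ∈ F) (hF : F ⊆ insert v S) (hv : v ∉ S) :
    (positions c S.card F).card = F.card - 1 := by
  rw [← Finset.card_erase_of_mem hvF, ← image_positions h hF hv, Finset.card_image_of_injOn]
  intro i hi j hj hij
  exact h.vert_injOn i j (mem_positions.1 hi).1 (mem_positions.1 hj).1 hij

theorem positions_inj {E' : Finset (Finset V)} (h : IsHamCycle E' S c ε) {F G : Finset V}
    (hvF : v ∈ F) (hF : F ⊆ insert v S) (hvG : v ∈ G) (hG : G ⊆ insert v S) (hv : v ∉ S)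
    (heq : positions c S.card F = positions c S.card G) : F = G := by
  rw [← Finset.insert_erase hvF, ← Finset.insert_erase hvG, ← image_positions h hF hv,
    ← image_positions h hG hv, heq]

/-- For `v` of degree two or three, the sets containing the successor of a position `j` of one edge
at `v`, and one of the successors of two positions `i`, `i'` of another edge, are too many. -/
theorem exists_isHamCycle_insert_of_card_le_three {r : ℕ}
    (h : IsHamCycle (E.filter (v ∉ ·)) S c ε) (hv : v ∉ S)
    (hE : ∀ e ∈ E, e ⊆ insert v S ∧ e.card = r) (hcard : S.card.choose r + 1 ≤ E.card)
    (hr : 3 ≤ r) (hS : r + 2 ≤ S.card) (hdeg : 2 ≤ (E.filter (v ∈ ·)).card)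
    (hdeg' : (E.filter (v ∈ ·)).card ≤ 3) : ∃ c' ε', IsHamCycle E (insert v S) c' ε' := by
  by_contra hno
  obtain ⟨F, hF, G, hG, hFG⟩ := Finset.one_lt_card.1 hdeg
  obtain ⟨hF, hvF⟩ := Finset.mem_filter.1 hF
  obtain ⟨hG, hvG⟩ := Finset.mem_filter.1 hG
  have hcF := card_positions h hvF (hE F hF).1 hv
  have hcG := card_positions h hvG (hE G hG).1 hv
  rw [(hE F hF).2] at hcF
  rw [(hE G hG).2] at hcG
  obtain ⟨i, hi, i', hi', hii'⟩ := Finset.one_lt_card.1 (show 1 < (positions c S.card F).card by omega)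
  obtain ⟨j, hj, hjF⟩ : ∃ j ∈ positions c S.card G, j ∉ positions c S.card F := by
    by_contra hcon
    push Not at hcon
    exact hFG (positions_inj h hvF (hE F hF).1 hvG (hE G hG).1 hv
      (Finset.eq_of_subset_of_card_le hcon (by omega)).symm)
  have hij : i ≠ j := fun heq => hjF (heq ▸ hi)
  have hij' : i' ≠ j := fun heq => hjF (heq ▸ hi')
  rw [mem_positions] at hi hi' hj
  have hl : Linked E v c i j := ⟨hij, F, hF, G, hG, hvF, hvG, hFG, hi.2, hj.2⟩
  have hl' : Linked E v c i' j := ⟨hij', F, hF, G, hG, hvF, hvG, hFG, hi'.2, hj.2⟩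
  have hinj : ∀ a b, a < S.card → b < S.card → a ≠ b → c (a + 1) ≠ c (b + 1) := by
    intro a b ha hb hab heq
    have := h.vert_inj_window (s := 0) (by omega) (by omega) (by omega) (by omega) heq
    omega
  have hA : ({i, i', j} : Finset ℕ).card = 3 := Finset.card_eq_three.2 ⟨i, i', j, hii', hij, hij', rfl⟩
  have hcount := card_filter_mem_and_mem_or_mem_ge (S := S) (r := r) (h.vert_mem (j + 1))
    (h.vert_mem (i + 1)) (h.vert_mem (i' + 1)) (hinj _ _ hj.1 hi.1 hij.symm)
    (hinj _ _ hj.1 hi'.1 hij'.symm) (hinj _ _ hi.1 hi'.1 hii') (by omega)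
  have hbound := card_add_card_le_of_linked h hv hE hcard hno (A := {i, i', j})
    (𝒯 := (S.powersetCard r).filter fun f => c (j + 1) ∈ f ∧ (c (i + 1) ∈ f ∨ c (i' + 1) ∈ f))
    (by simp [Finset.insert_subset_iff, hi.1, hi'.1, hj.1]) (Finset.filter_subset _ _) (by
      intro f hf
      obtain ⟨-, h1, h2 | h2⟩ := Finset.mem_filter.1 hf
      · exact ⟨i, by simp, j, by simp, hl, h2, h1⟩
      · exact ⟨i', by simp, j, by simp, hl', h2, h1⟩) (by
      intro f hf a ha _
      obtain ⟨-, h1, h2⟩ := Finset.mem_filter.1 hf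
      simp only [Finset.mem_insert, Finset.mem_singleton] at ha
      rcases ha with rfl | rfl | rfl
      · exact ⟨j, by simp, hl, h1⟩
      · exact ⟨j, by simp, hl', h1⟩
      · rcases h2 with h2 | h2
        · exact ⟨i, by simp, hl.symm, h2⟩
        · exact ⟨i', by simp, hl'.symm, h2⟩)
  have h1 := le_choose_self (M := S.card - 2) (k := r - 2) (by omega) (by omega)
  have h2 := le_choose_self (M := S.card - 3) (k := r - 2) (by omega) (by omega)
  rw [hA] at hbound
  omega

/-- For `v` of degree at least four, take a maximal set `A` of pairwise linked positions. An edge at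
`v` has all its positions in `A` or is the only edge at some position in `A`, which bounds the degree
of `v`, whereas all sets containing exactly two successors of positions in `A` are missing or lie on
the cycle. -/
theorem exists_isHamCycle_insert_of_four_le {r : ℕ}
    (h : IsHamCycle (E.filter (v ∉ ·)) S c ε) (hv : v ∉ S)
    (hE : ∀ e ∈ E, e ⊆ insert v S ∧ e.card = r) (hcard : S.card.choose r + 1 ≤ E.card)
    (hr : 3 ≤ r) (hdeg : 4 ≤ (E.filter (v ∈ ·)).card) :
    ∃ c' ε', IsHamCycle E (insert v S) c' ε' := by
  classical
  by_contra hno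
  have hpos := h.card_pos
  set N := S.card with hN
  set 𝓕 := E.filter (v ∈ ·) with h𝓕
  have hmem : ∀ F, F ∈ 𝓕 ↔ F ∈ E ∧ v ∈ F := fun F => Finset.mem_filter
  -- consecutive positions are not linked, else `v` could be inserted between them
  have hsucc : ∀ i F G, F ∈ 𝓕 → G ∈ 𝓕 → F ≠ G → c i ∈ F → c ((i + 1) % N) ∉ G := by
    intro i F G hF hG hFG hi hj
    rw [h.vert_periodic.map_mod_nat] at hj
    rw [hmem] at hF hG
    exact hno (h.insert_vertex hv hF.1 hG.1 hF.2 hG.2 hFG hi hj)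
  have h2r : 2 * (r - 1) ≤ N := by
    obtain ⟨F, hF, G, hG, hFG⟩ := Finset.one_lt_card.1 (show 1 < 𝓕.card by omega)
    have hF' := (hmem F).1 hF
    have hG' := (hmem G).1 hG
    have h1 := card_positions h hF'.2 (hE F hF'.1).1 hv
    have h2 := card_positions h hG'.2 (hE G hG'.1).1 hv
    rw [(hE F hF'.1).2, ← hN] at h1
    rw [(hE G hG'.1).2, ← hN] at h2
    have := card_add_card_le_of_succ_notMem hpos (X := positions c N F) (Y := positions c N G)
      (Finset.filter_subset _ _) (Finset.filter_subset _ _) fun i hi hi' =>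
        hsucc i F G hF hG hFG (mem_positions.1 hi).2 (mem_positions.1 hi').2
    omega
  -- a maximal set of pairwise linked positions
  obtain ⟨Q, hQ⟩ : ∃ Q : Finset ℕ → Prop, ∀ A, Q A ↔ (∀ i ∈ A, ∃ F ∈ 𝓕, c i ∈ F) ∧
      ∀ i ∈ A, ∀ j ∈ A, i ≠ j → Linked E v c i j := ⟨_, fun _ => Iff.rfl⟩
  obtain ⟨A, hAmem, hAmax⟩ := Finset.exists_max_image ((Finset.range N).powerset.filter Q)
    Finset.card ⟨∅, by simp [hQ]⟩
  obtain ⟨hAN, hAQ⟩ := Finset.mem_filter.1 hAmem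
  obtain ⟨hAcov, hAlink⟩ := (hQ A).1 hAQ
  rw [Finset.mem_powerset] at hAN
  set s := A.card with hs
  have hdeg_le : 𝓕.card ≤ s.choose (r - 1) + s := by
    have hsub : 𝓕 ⊆ 𝓕.filter (positions c N · ⊆ A) ∪
        A.biUnion fun j => 𝓕.filter fun F => c j ∈ F ∧ ∀ G ∈ 𝓕, c j ∈ G → G = F := by
      intro F hF
      by_cases hFA : positions c N F ⊆ A
      · exact Finset.mem_union_left _ (Finset.mem_filter.2 ⟨hF, hFA⟩)
      obtain ⟨i, hiF, hiA⟩ := Finset.not_subset.1 hFA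
      rw [mem_positions] at hiF
      -- by maximality, `i` is not linked to some `j ∈ A`, so `F` is the only edge at `j`
      obtain ⟨j, hjA, hij⟩ : ∃ j ∈ A, ¬ Linked E v c i j := by
        by_contra hcon
        push Not at hcon
        have hins := hAmax (insert i A) (Finset.mem_filter.2 ⟨?_, (hQ _).2 ⟨?_, ?_⟩⟩)
        · rw [Finset.card_insert_of_notMem hiA] at hins
          omega
        · exact Finset.mem_powerset.2 (Finset.insert_subset (Finset.mem_range.2 hiF.1) hAN)
        · intro k hk
          rcases Finset.mem_insert.1 hk with rfl | hk
          · exact ⟨F, hF, hiF.2⟩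
          · exact hAcov k hk
        · intro a ha b hb hab
          rcases Finset.mem_insert.1 ha with ha' | ha' <;>
            rcases Finset.mem_insert.1 hb with hb' | hb'
          · exact absurd (ha'.trans hb'.symm) hab
          · exact ha' ▸ hcon b hb'
          · exact hb' ▸ (hcon a ha').symm
          · exact hAlink a ha' b hb' hab
      have honly : ∀ G ∈ 𝓕, c j ∈ G → G = F := by
        intro G hG hjG
        by_contra hne
        exact hij ⟨fun heq => hiA (heq ▸ hjA), F, ((hmem F).1 hF).1, G, ((hmem G).1 hG).1,
          ((hmem F).1 hF).2, ((hmem G).1 hG).2, Ne.symm hne, hiF.2, hjG⟩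
      obtain ⟨G, hG, hjG⟩ := hAcov j hjA
      exact Finset.mem_union_right _ (Finset.mem_biUnion.2 ⟨j, hjA, Finset.mem_filter.2
        ⟨hF, honly G hG hjG ▸ hjG, honly⟩⟩)
    refine (Finset.card_le_card hsub).trans ((Finset.card_union_le _ _).trans (add_le_add ?_ ?_))
    · rw [← Finset.card_powersetCard]
      refine Finset.card_le_card_of_injOn (positions c N) ?_ ?_
      · intro F hF
        obtain ⟨hF, hFA⟩ := Finset.mem_filter.1 hF
        rw [hmem] at hF
        refine Finset.mem_powersetCard.2 ⟨hFA, ?_⟩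
        rw [card_positions h hF.2 (hE F hF.1).1 hv, (hE F hF.1).2]
      · intro F hF G hG heq
        have hF := (hmem F).1 (Finset.mem_filter.1 hF).1
        have hG := (hmem G).1 (Finset.mem_filter.1 hG).1
        exact positions_inj h hF.2 (hE F hF.1).1 hG.2 (hE G hG.1).1 hv heq
    · refine (Finset.card_biUnion_le_card_mul _ _ 1 fun j _ => ?_).trans (mul_one _).le
      refine Finset.card_le_one.2 fun F hF G hG => ?_
      obtain ⟨hF, hjF, -⟩ := Finset.mem_filter.1 hF
      obtain ⟨-, -, honly⟩ := Finset.mem_filter.1 hG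
      exact honly F hF hjF
  have hs3 : 3 ≤ s := by
    by_contra hlt
    have h1 : s.choose (r - 1) ≤ 1 := by
      refine (Nat.choose_le_choose (r - 1) (show s ≤ 2 by omega)).trans ?_
      rcases (show r = 3 ∨ 2 < r - 1 by omega) with rfl | h3
      · decide
      · simp [Nat.choose_eq_zero_of_lt h3]
    omega
  have h2s : s + s ≤ N := by
    refine card_add_card_le_of_succ_notMem hpos hAN hAN fun i hi hi' => ?_
    have hne : i ≠ (i + 1) % N := by
      have hiN := Finset.mem_range.1 (hAN hi)
      intro heq
      rcases (show i + 1 < N ∨ i + 1 = N by omega) with h1 | h1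
      · rw [Nat.mod_eq_of_lt h1] at heq; omega
      · rw [h1, Nat.mod_self] at heq; omega
    obtain ⟨-, F, hF, G, hG, hvF, hvG, hFG, hiF, hjG⟩ := hAlink i hi _ hi' hne
    exact hsucc i F G ((hmem F).2 ⟨hF, hvF⟩) ((hmem G).2 ⟨hG, hvG⟩) hFG hiF hjG
  set B := A.image (fun i => c (i + 1)) with hB
  have hBS : B ⊆ S := by
    intro w hw
    obtain ⟨i, -, rfl⟩ := Finset.mem_image.1 hw
    exact h.vert_mem _
  have hBcard : B.card = s := by
    refine Finset.card_image_of_injOn fun i hi j hj hij => ?_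
    have hi := Finset.mem_range.1 (hAN hi)
    have hj := Finset.mem_range.1 (hAN hj)
    have := h.vert_inj_window (s := 0) (by omega) (by omega) (by omega) (by omega) hij
    omega
  have hpair : ∀ f ∈ pairFamily S B r,
      ∃ a ∈ A, ∃ b ∈ A, a ≠ b ∧ c (a + 1) ∈ f ∧ c (b + 1) ∈ f := by
    intro f hf
    obtain ⟨-, x, hx, y, hy, hxy, hxf, hyf⟩ := mem_pairFamily hBS (by omega) hf
    obtain ⟨a, ha, rfl⟩ := Finset.mem_image.1 hx
    obtain ⟨b, hb, rfl⟩ := Finset.mem_image.1 hy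
    exact ⟨a, ha, b, hb, fun heq => hxy (by rw [heq]), hxf, hyf⟩
  have hbound := card_add_card_le_of_linked h hv hE hcard hno hAN (𝒯 := pairFamily S B r)
    (fun f hf => (mem_pairFamily hBS (by omega) hf).1) (by
      intro f hf
      obtain ⟨a, ha, b, hb, hab, haf, hbf⟩ := hpair f hf
      exact ⟨a, ha, b, hb, hAlink a ha b hb hab, haf, hbf⟩) (by
      intro f hf k hk _
      obtain ⟨a, ha, b, hb, hab, haf, hbf⟩ := hpair f hf
      by_cases hka : k = a
      · exact ⟨b, hb, hAlink k hk b hb (hka ▸ hab), hbf⟩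
      · exact ⟨a, ha, hAlink k hk a ha hka, haf⟩)
  rw [card_pairFamily S B hBS, hBcard, ← hN, ← h𝓕] at hbound
  have harith := choose_two_mul_choose_gt (d := N - s) hs3 (by omega) hr (by omega)
  have h1 : s + (N - s) = N := by omega
  rw [h1] at harith
  omega

end insertion

/-! ### Five vertices, uniformity three -/

/-- The ten triples of `{0, 1, 2, 3, 4}`: whether the `k`-th of them contains `i`. -/
def tripleMem (k i : ℕ) : Bool :=
  ([7, 11, 19, 13, 21, 25, 14, 22, 26, 28].getD k 0).testBit i

/-- Depth-first search for distinct indices outside `used`, one from each of the given lists, all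
satisfying `b`. -/
def findDistinct (b : ℕ → Bool) : List (List ℕ) → List ℕ → Bool
  | [], _ => true
  | o :: os, used => o.any fun k => b k && !used.contains k && findDistinct b os (k :: used)

theorem exists_of_findDistinct {b : ℕ → Bool} : ∀ {os : List (List ℕ)} {used : List ℕ},
    findDistinct b os used = true → ∃ τ : List ℕ, τ.Nodup ∧ (∀ k ∈ τ, k ∉ used ∧ b k = true) ∧
      List.Forall₂ (· ∈ ·) τ os
  | [], _, _ => ⟨[], by simp⟩
  | o :: os, used, h => by
    rw [findDistinct, List.any_eq_true] at h
    obtain ⟨k, hko, hk⟩ := h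
    simp only [Bool.and_eq_true, Bool.not_eq_true', List.contains_eq_mem,
      decide_eq_false_iff_not] at hk
    obtain ⟨τ, hnd, hτ, hos⟩ := exists_of_findDistinct hk.2
    refine ⟨k :: τ, List.nodup_cons.2 ⟨fun hkτ => (hτ k hkτ).1 List.mem_cons_self, hnd⟩, ?_,
      List.Forall₂.cons hko hos⟩
    intro a ha
    rcases List.mem_cons.1 ha with rfl | ha
    · exact ⟨hk.1.2, hk.1.1⟩
    · exact ⟨fun hau => (hτ a ha).1 (List.mem_cons_of_mem _ hau), (hτ a ha).2⟩

/-- The cyclic orders of five vertices, up to reversal. -/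
def fiveOrders : List (List ℕ) :=
  [[0, 1, 2, 3, 4], [0, 1, 3, 2, 4], [0, 1, 2, 4, 3], [0, 1, 4, 2, 3], [0, 1, 3, 4, 2],
    [0, 1, 4, 3, 2], [0, 2, 1, 4, 3], [0, 2, 4, 1, 3], [0, 2, 1, 3, 4], [0, 2, 3, 1, 4],
    [0, 3, 1, 2, 4], [0, 3, 2, 1, 4]]

/-- For each pair of consecutive vertices in the cyclic order `σ`, the triples containing it. -/
def pairTriples (σ : List ℕ) : List (List ℕ) :=
  (List.range 5).map fun i => (List.range 10).filter fun k =>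
    tripleMem k (σ.getD i 0) && tripleMem k (σ.getD ((i + 1) % 5) 0)

/-- At least five triples satisfy `b`, and every vertex lies in at least two of them. -/
def fiveCondition (b : ℕ → Bool) : Bool :=
  Nat.ble 5 ((List.range 10).filter b).length &&
    (List.range 5).all fun i =>
      Nat.ble 2 ((List.range 10).filter fun k => b k && tripleMem k i).length

/-- Checked by evaluation for all sets of triples, given by their indicator functions. -/
theorem fiveOrders_any : ∀ b0 b1 b2 b3 b4 b5 b6 b7 b8 b9 : Bool,
    (!fiveCondition (fun k => [b0, b1, b2, b3, b4, b5, b6, b7, b8, b9].getD k false) ||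
      fiveOrders.any fun σ => findDistinct
        (fun k => [b0, b1, b2, b3, b4, b5, b6, b7, b8, b9].getD k false) (pairTriples σ) []) =
      true := by
  decide +kernel

theorem exists_tripleMem : ∀ t ∈ (Finset.range 5).powersetCard 3,
    ∃ k < 10, (Finset.range 5).filter (fun i => tripleMem k i) = t := by
  decide +kernel

theorem tripleMem_ext : ∀ k < 10, ∀ l < 10,
    (∀ i < 5, tripleMem k i = tripleMem l i) → k = l := by
  decide +kernel

theorem fiveOrders_valid : ∀ σ ∈ fiveOrders, σ.length = 5 ∧ σ.Nodup ∧ ∀ i ∈ σ, i < 5 := by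
  decide +kernel

/-- An enumeration of a finite set with prescribed first elements. -/
theorem exists_enumeration {V : Type*} [DecidableEq V] (S : Finset V) (l : List V) (hl : l.Nodup)
    (hlS : ∀ v ∈ l, v ∈ S) (hS : S.Nonempty) : ∃ c : ℕ → V, (∀ i, c i ∈ S) ∧
      (∀ i j, i < S.card → j < S.card → c i = c j → i = j) ∧ ∀ i (h : i < l.length), c i = l[i] := by
  obtain ⟨v, hv⟩ := hS
  set l' := l ++ (S \ l.toFinset).toList with hl'
  have hnd : l'.Nodup := by
    refine List.Nodup.append hl (Finset.nodup_toList _) ?_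
    intro a ha hb
    simp only [Finset.mem_toList, Finset.mem_sdiff, List.mem_toFinset] at hb
    exact hb.2 ha
  have hmem : ∀ a, a ∈ l' ↔ a ∈ S := by
    intro a
    simp only [hl', List.mem_append, Finset.mem_toList, Finset.mem_sdiff, List.mem_toFinset]
    have := hlS a
    tauto
  have hlen : l'.length = S.card := by
    rw [← List.toFinset_card_of_nodup hnd]
    congr 1
    ext a
    rw [List.mem_toFinset, hmem]
  refine ⟨fun i => l'.getD i v, fun i => ?_, fun i j hi hj hij => ?_, fun i h => ?_⟩
  · beta_reduce
    by_cases hi : i < l'.length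
    · rw [List.getD_eq_getElem _ _ hi]
      exact (hmem _).1 (List.getElem_mem hi)
    · rw [List.getD_eq_default _ _ (not_lt.1 hi)]
      exact hv
  · rw [← hlen] at hi hj
    beta_reduce at hij
    rw [List.getD_eq_getElem _ _ hi, List.getD_eq_getElem _ _ hj] at hij
    exact (List.Nodup.getElem_inj_iff hnd).1 hij
  · have h2 : i < l'.length := by rw [hl', List.length_append]; omega
    beta_reduce
    rw [List.getD_eq_getElem _ _ h2]
    exact List.getElem_append_left h

/-- The vertices are numbered `0, …, 4`, which turns `E` into a set `b` of the ten triples of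
`{0, 1, 2, 3, 4}`. -/
theorem exists_isHamCycle_of_card_eq_five {V : Type*} [DecidableEq V] {E : Finset (Finset V)}
    {S : Finset V} (hS : S.card = 5) (hE : ∀ e ∈ E, e ⊆ S ∧ e.card = 3) (hcard : 5 ≤ E.card)
    (hdeg : ∀ v ∈ S, 2 ≤ (E.filter (v ∈ ·)).card) : ∃ c ε, IsHamCycle E S c ε := by
  obtain ⟨c, hcS, hcinj, -⟩ := exists_enumeration S [] (by simp) (by simp)
    (Finset.card_pos.1 (by omega))
  set T : ℕ → Finset V := fun k => ((Finset.range 5).filter fun i => tripleMem k i).image c with hT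
  have hmemT : ∀ k, ∀ i < 5, (c i ∈ T k ↔ tripleMem k i = true) := by
    intro k i hi
    simp only [hT, Finset.mem_image, Finset.mem_filter, Finset.mem_range]
    constructor
    · rintro ⟨j, ⟨hj, hjk⟩, hij⟩
      rwa [← hcinj j i (by omega) (by omega) hij]
    · intro h
      exact ⟨i, ⟨hi, h⟩, rfl⟩
  have hTinj : ∀ k < 10, ∀ l < 10, T k = T l → k = l := by
    intro k hk l hl hkl
    refine tripleMem_ext k hk l hl fun i hi => ?_
    rw [Bool.eq_iff_iff, ← hmemT k i hi, ← hmemT l i hi, hkl]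
  have hsurj : ∀ e ∈ E, ∃ k < 10, T k = e := by
    intro e he
    have himg : ((Finset.range 5).filter (c · ∈ e)).image c = e := by
      ext w
      simp only [Finset.mem_image, Finset.mem_filter, Finset.mem_range]
      constructor
      · rintro ⟨i, ⟨-, hi⟩, rfl⟩
        exact hi
      · intro hw
        obtain ⟨i, hi, rfl⟩ := exists_vert_of_injOn hcS hcinj ((hE e he).1 hw)
        exact ⟨i, ⟨by omega, hw⟩, rfl⟩
    have hc3 : ((Finset.range 5).filter (c · ∈ e)).card = 3 := by
      rw [← (hE e he).2]
      conv_rhs => rw [← himg]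
      rw [Finset.card_image_of_injOn]
      intro i hi j hj hij
      have hi := Finset.mem_range.1 (Finset.mem_filter.1 hi).1
      have hj := Finset.mem_range.1 (Finset.mem_filter.1 hj).1
      exact hcinj i j (by omega) (by omega) hij
    obtain ⟨k, hk, hkt⟩ := exists_tripleMem _
      (Finset.mem_powersetCard.2 ⟨Finset.filter_subset _ _, hc3⟩)
    exact ⟨k, hk, by rw [hT]; simp only [hkt]; exact himg⟩
  set b : ℕ → Bool := fun k => [decide (T 0 ∈ E), decide (T 1 ∈ E), decide (T 2 ∈ E),
    decide (T 3 ∈ E), decide (T 4 ∈ E), decide (T 5 ∈ E), decide (T 6 ∈ E), decide (T 7 ∈ E),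
    decide (T 8 ∈ E), decide (T 9 ∈ E)].getD k false with hb
  have hbT : ∀ k < 10, (b k = true ↔ T k ∈ E) := by
    intro k hk
    interval_cases k <;> simp [hb]
  have hcount : ∀ (P : Finset V → Prop) [DecidablePred P] (p : ℕ → Bool),
      (∀ k < 10, T k ∈ E → P (T k) → p k = true) →
      (E.filter P).card ≤ ((List.range 10).filter p).length := by
    intro P _ p hp
    refine le_trans (Finset.card_le_card (t := ((List.range 10).filter p).toFinset.image T) ?_)
      (Finset.card_image_le.trans (List.toFinset_card_le _))
    intro e he
    obtain ⟨heE, heP⟩ := Finset.mem_filter.1 he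
    obtain ⟨k, hk, rfl⟩ := hsurj e heE
    refine Finset.mem_image_of_mem _ ?_
    rw [List.mem_toFinset, List.mem_filter, List.mem_range]
    exact ⟨hk, hp k hk heE heP⟩
  have hcond : fiveCondition b = true := by
    rw [fiveCondition, Bool.and_eq_true, Nat.ble_eq, List.all_eq_true]
    constructor
    · refine hcard.trans ?_
      have := hcount (fun _ => True) b fun k hk hkE _ => (hbT k hk).2 hkE
      rwa [Finset.filter_true] at this
    · intro i hi
      rw [List.mem_range] at hi
      rw [Nat.ble_eq]
      refine (hdeg (c i) (hcS i)).trans (hcount _ _ fun k hk hkE hik => ?_)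
      rw [Bool.and_eq_true]
      exact ⟨(hbT k hk).2 hkE, (hmemT k i hi).1 hik⟩
  have hany := fiveOrders_any (decide (T 0 ∈ E)) (decide (T 1 ∈ E)) (decide (T 2 ∈ E))
    (decide (T 3 ∈ E)) (decide (T 4 ∈ E)) (decide (T 5 ∈ E)) (decide (T 6 ∈ E)) (decide (T 7 ∈ E))
    (decide (T 8 ∈ E)) (decide (T 9 ∈ E))
  rw [← hb, hcond, Bool.not_true, Bool.false_or, List.any_eq_true] at hany
  obtain ⟨σ, hσ, hfind⟩ := hany
  obtain ⟨hσlen, hσnd, hσlt⟩ := fiveOrders_valid σ hσ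
  obtain ⟨τ, hτnd, hτb, hτσ⟩ := exists_of_findDistinct hfind
  have hτlen : τ.length = 5 := by
    rw [hτσ.length_eq]
    simp [pairTriples]
  have hτ : ∀ i (hi : i < 5), τ.getD i 0 < 10 ∧ T (τ.getD i 0) ∈ E ∧
      tripleMem (τ.getD i 0) (σ.getD i 0) = true ∧
      tripleMem (τ.getD i 0) (σ.getD ((i + 1) % 5) 0) = true := by
    intro i hi
    have h1 := hτσ.get (by omega : i < τ.length) (by simpa [pairTriples] using hi)
    simp only [pairTriples, List.get_eq_getElem, List.getElem_map, List.getElem_range,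
      List.mem_filter, List.mem_range, Bool.and_eq_true] at h1
    rw [List.getD_eq_getElem _ _ (by omega : i < τ.length)]
    refine ⟨h1.1, (hbT _ h1.1).1 (hτb _ (List.getElem_mem _)).2, h1.2⟩
  have hσ5 : ∀ i < 5, σ.getD i 0 < 5 := by
    intro i hi
    rw [List.getD_eq_getElem _ _ (by omega : i < σ.length)]
    exact hσlt _ (List.getElem_mem _)
  refine exists_isHamCycle (N := 5) (c := fun i => c (σ.getD i 0))
    (ε := fun i => T (τ.getD i 0)) hS (by norm_num) (fun i _ => hcS _) (fun i hi => (hτ i hi).2.1)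
    (fun i hi => (hmemT _ _ (hσ5 i hi)).2 (hτ i hi).2.2.1) (fun i hi => ?_) ?_ ?_ ?_
  · have h := (hτ i (by omega)).2.2.2
    rw [Nat.mod_eq_of_lt hi] at h
    exact (hmemT _ _ (hσ5 _ hi)).2 h
  · exact (hmemT _ _ (hσ5 0 (by norm_num))).2 (hτ 4 (by norm_num)).2.2.2
  · intro i j hi hj hij
    have := hcinj _ _ (by have := hσ5 i hi; omega) (by have := hσ5 j hj; omega) hij
    rw [List.getD_eq_getElem _ _ (by omega : i < σ.length),
      List.getD_eq_getElem _ _ (by omega : j < σ.length)] at this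
    exact (List.Nodup.getElem_inj_iff hσnd).1 this
  · intro i j hi hj hij
    have := hTinj _ (hτ i hi).1 _ (hτ j hj).1 hij
    rw [List.getD_eq_getElem _ _ (by omega : i < τ.length),
      List.getD_eq_getElem _ _ (by omega : j < τ.length)] at this
    exact (List.Nodup.getElem_inj_iff hτnd).1 this

/-! ### Uniformity two less than the number of vertices -/

/-- The two-element subsets of `Fin n` meeting `{i, i + 1}` for all `i ∈ A`. -/
def pairTransversals {n : ℕ} [NeZero n] (A : Finset (Fin n)) : Finset (Finset (Fin n)) :=
  ((Finset.univ : Finset (Fin n)).powersetCard 2).filter fun T => ∀ i ∈ A, i ∈ T ∨ i + 1 ∈ T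

theorem card_le_four_of_mem_pairTransversals {n : ℕ} [NeZero n] {A T : Finset (Fin n)}
    (hT : T ∈ pairTransversals A) : A.card ≤ 4 := by
  obtain ⟨hT, hA⟩ := Finset.mem_filter.1 hT
  obtain ⟨y, z, -, rfl⟩ := Finset.card_eq_two.1 (Finset.mem_powersetCard.1 hT).2
  have : A ⊆ {y, y - 1, z, z - 1} := by
    intro i hi
    have := hA i hi
    simp only [Finset.mem_insert, Finset.mem_singleton, eq_sub_iff_add_eq] at this ⊢
    tauto
  exact (Finset.card_le_card this).trans Finset.card_le_four

theorem card_pairTransversals_le_four {n : ℕ} [NeZero n] {A : Finset (Fin n)} {i j : Fin n}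
    (hi : i ∈ A) (hj : j ∈ A) (hij : i ≠ j) (h1 : i ≠ j + 1) (h2 : j ≠ i + 1) :
    (pairTransversals A).card ≤ 4 := by
  have hsub : pairTransversals A ⊆ {{i, j}, {i, j + 1}, {i + 1, j}, {i + 1, j + 1}} := by
    intro T hT
    obtain ⟨hT, hA⟩ := Finset.mem_filter.1 hT
    have hTc := (Finset.mem_powersetCard.1 hT).2
    have key : ∀ y z, y ∈ T → z ∈ T → y ≠ z → T = {y, z} := by
      intro y z hy hz hyz
      refine (Finset.eq_of_subset_of_card_le ?_ ?_).symm
      · simp [Finset.insert_subset_iff, hy, hz]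
      · rw [Finset.card_pair hyz, hTc]
    have h3 : i + 1 ≠ j + 1 := fun h => hij (add_right_cancel h)
    simp only [Finset.mem_insert, Finset.mem_singleton]
    rcases hA i hi with hy | hy <;> rcases hA j hj with hz | hz
    · exact Or.inl (key _ _ hy hz hij)
    · exact Or.inr (Or.inl (key _ _ hy hz h1))
    · exact Or.inr (Or.inr (Or.inl (key _ _ hy hz h2.symm)))
    · exact Or.inr (Or.inr (Or.inr (key _ _ hy hz h3)))
  exact (Finset.card_le_card hsub).trans Finset.card_le_four

theorem val_add_one_cases {n : ℕ} (i : Fin (n + 2)) :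
    ((i + 1 : Fin (n + 2)) : ℕ) = i + 1 ∧ (i : ℕ) + 1 < n + 2 ∨
      ((i + 1 : Fin (n + 2)) : ℕ) = 0 ∧ (i : ℕ) + 1 = n + 2 := by
  rw [Fin.val_add_one]
  split_ifs with h
  · right
    simp [h]
  · left
    have : (i : ℕ) ≠ n + 1 := fun h' => h (Fin.ext (by simpa using h'))
    have := i.2
    omega

/-- On a cycle of length at least four, three positions are not pairwise adjacent. -/
theorem exists_not_adjacent {n : ℕ} (hn : 2 ≤ n) {A : Finset (Fin (n + 2))} (hA : 3 ≤ A.card) :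
    ∃ i ∈ A, ∃ j ∈ A, i ≠ j ∧ i ≠ j + 1 ∧ j ≠ i + 1 := by
  obtain ⟨i, j, k, hi, hj, hk, hij, hik, hjk⟩ := Finset.two_lt_card_iff.1 hA
  by_contra hcon
  push Not at hcon
  have h1 := hcon i hi j hj hij
  have h2 := hcon i hi k hk hik
  have h3 := hcon j hj k hk hjk
  simp only [Ne, Fin.ext_iff] at *
  have hi' := val_add_one_cases i
  have hj' := val_add_one_cases j
  have hk' := val_add_one_cases k
  omega

theorem card_add_card_pairTransversals_six : ∀ A : Finset (Fin (4 + 2)), 3 ≤ A.card →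
    (pairTransversals A).card = 0 ∨ A.card + (pairTransversals A).card ≤ 6 := by
  decide +kernel

theorem card_add_card_pairTransversals_seven : ∀ A : Finset (Fin (5 + 2)), 3 ≤ A.card →
    (pairTransversals A).card = 0 ∨ A.card + (pairTransversals A).card ≤ 6 := by
  decide +kernel

theorem card_add_card_pairTransversals_le {n : ℕ} (hn : 4 ≤ n) {A : Finset (Fin (n + 2))}
    (hA : 3 ≤ A.card) : A.card + (pairTransversals A).card ≤ n + 2 := by
  have hAn : A.card ≤ n + 2 := (Finset.card_le_univ A).trans (Fintype.card_fin _).le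
  rcases (show n = 4 ∨ n = 5 ∨ 6 ≤ n by omega) with rfl | rfl | hn6
  · have := card_add_card_pairTransversals_six A hA
    omega
  · have := card_add_card_pairTransversals_seven A hA
    omega
  · rcases (pairTransversals A).eq_empty_or_nonempty with h | ⟨T, hT⟩
    · simpa [h] using hAn
    · obtain ⟨i, hi, j, hj, hij, h1, h2⟩ := exists_not_adjacent (by omega) hA
      have := card_le_four_of_mem_pairTransversals hT
      have := card_pairTransversals_le_four hi hj hij h1 h2
      omega

section codimension_two

variable {V : Type*} [DecidableEq V] {E : Finset (Finset V)} {S : Finset V} {r : ℕ}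

theorem card_filter_notMem_and_notMem_le_one (hS : S.card = r + 2)
    (hE : ∀ e ∈ E, e ⊆ S ∧ e.card = r) {a b : V} (ha : a ∈ S) (hb : b ∈ S) (hab : a ≠ b) :
    (E.filter fun e => a ∉ e ∧ b ∉ e).card ≤ 1 := by
  have hsub : (E.filter fun e => a ∉ e ∧ b ∉ e) ⊆ {S \ {a, b}} := by
    intro e he
    obtain ⟨he, hae, hbe⟩ := Finset.mem_filter.1 he
    rw [Finset.mem_singleton]
    refine Finset.eq_of_subset_of_card_le ?_ ?_
    · intro w hw
      rw [Finset.mem_sdiff, Finset.mem_insert, Finset.mem_singleton]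
      refine ⟨(hE e he).1 hw, ?_⟩
      rintro (rfl | rfl)
      exacts [hae hw, hbe hw]
    · rw [Finset.card_sdiff_of_subset (by simp [Finset.insert_subset_iff, ha, hb]),
        Finset.card_pair hab, (hE e he).2, hS]
      omega
  exact (Finset.card_le_card hsub).trans (Finset.card_singleton _).le

theorem card_le_card_filter_add (p q : Finset V → Prop) [DecidablePred p] [DecidablePred q] :
    E.card ≤ (E.filter p).card + (E.filter q).card +
      (E.filter fun e => ¬ p e ∧ ¬ q e).card := by
  have h := Finset.card_filter_add_card_filter_not (s := E) (fun e => p e ∨ q e)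
  have h2 : (E.filter fun e => p e ∨ q e).card ≤ (E.filter p).card + (E.filter q).card := by
    rw [Finset.filter_or]
    exact Finset.card_union_le _ _
  simp only [not_or] at h
  omega

/-- An edge contains two given vertices, if neither has minimum degree. -/
theorem exists_mem_mem_of_min_degree (hS : S.card = r + 2)
    (hE : ∀ e ∈ E, e ⊆ S ∧ e.card = r) (hcard : 6 ≤ E.card) {x a b : V} (hx : x ∈ S) (ha : a ∈ S)
    (hb : b ∈ S) (hxa : x ≠ a) (hxb : x ≠ b)
    (hmina : (E.filter (x ∈ ·)).card ≤ (E.filter (a ∈ ·)).card)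
    (hminb : (E.filter (x ∈ ·)).card ≤ (E.filter (b ∈ ·)).card) : ∃ e ∈ E, a ∈ e ∧ b ∈ e := by
  by_contra hcon
  push Not at hcon
  have h1 : (E.filter (x ∉ ·)).card ≤ 1 + 1 := by
    refine le_trans (Finset.card_le_card ?_) ((Finset.card_union_le _ _).trans (add_le_add
      (card_filter_notMem_and_notMem_le_one hS hE hx ha hxa)
      (card_filter_notMem_and_notMem_le_one hS hE hx hb hxb)))
    intro e he
    obtain ⟨he, hxe⟩ := Finset.mem_filter.1 he
    rw [Finset.mem_union, Finset.mem_filter, Finset.mem_filter]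
    have := hcon e he
    tauto
  have h2 : (E.filter (a ∈ ·)).card + (E.filter (b ∈ ·)).card ≤ E.card := by
    rw [← Finset.card_union_of_disjoint]
    · exact Finset.card_le_card (Finset.union_subset (Finset.filter_subset _ _)
        (Finset.filter_subset _ _))
    · rw [Finset.disjoint_left]
      intro e he he'
      exact hcon e (Finset.mem_filter.1 he).1 (Finset.mem_filter.1 he).2 (Finset.mem_filter.1 he').2
  have h3 := Finset.card_filter_add_card_filter_not (s := E) (x ∈ ·)
  omega

/-- At least two edges contain `b` and one of `a`, `d`, if `b` is not of minimum degree. -/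
theorem two_le_card_filter_of_min_degree (hS : S.card = r + 2)
    (hE : ∀ e ∈ E, e ⊆ S ∧ e.card = r) (hcard : 6 ≤ E.card) {x a b d : V} (hx : x ∈ S) (ha : a ∈ S)
    (hb : b ∈ S) (hd : d ∈ S) (hxb : x ≠ b) (had : a ≠ d)
    (hmin : (E.filter (x ∈ ·)).card ≤ (E.filter (b ∈ ·)).card) :
    2 ≤ (E.filter fun e => b ∈ e ∧ (a ∈ e ∨ d ∈ e)).card := by
  have h1 := card_filter_notMem_and_notMem_le_one hS hE hx hb hxb
  have h2 := card_filter_notMem_and_notMem_le_one hS hE ha hd had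
  have h3 := card_le_card_filter_add (E := E) (x ∈ ·) (b ∈ ·)
  have h4 : (E.filter (b ∈ ·)).card ≤ (E.filter fun e => b ∈ e ∧ (a ∈ e ∨ d ∈ e)).card +
      (E.filter fun e => a ∉ e ∧ d ∉ e).card := by
    refine le_trans (Finset.card_le_card ?_) (Finset.card_union_le _ _)
    intro e he
    rw [Finset.mem_union, Finset.mem_filter, Finset.mem_filter]
    rw [Finset.mem_filter] at he
    tauto
  omega

/-- Hall's condition for the pairs of cyclically consecutive vertices and the edges containing them
holds for every cyclic order in which a vertex `x` of minimum degree has neighbours `q` and `p`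
lying with `x` in distinct edges. -/
theorem exists_isHamCycle_of_card_eq_add_two (hr : 4 ≤ r) (hS : S.card = r + 2)
    (hE : ∀ e ∈ E, e ⊆ S ∧ e.card = r) (hcard : r + 2 ≤ E.card)
    (hdeg : ∀ v ∈ S, 2 ≤ (E.filter (v ∈ ·)).card) : ∃ c ε, IsHamCycle E S c ε := by
  obtain ⟨x, hx, hmin⟩ := S.exists_min_image (fun v => (E.filter (v ∈ ·)).card)
    (Finset.card_pos.1 (by omega))
  obtain ⟨f, hf, g, hg, hfg⟩ := Finset.one_lt_card.1 (hdeg x hx)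
  obtain ⟨hf, hxf⟩ := Finset.mem_filter.1 hf
  obtain ⟨hg, hxg⟩ := Finset.mem_filter.1 hg
  -- the cyclic order starts with `q, x, p`, where `f ∋ q, x` and `g ∋ x, p`
  have hdiff : ∀ f g, f ∈ E → g ∈ E → f ≠ g → ∃ q ∈ f, q ∉ g := by
    intro f g hf hg hfg
    by_contra hcon
    push Not at hcon
    exact hfg (Finset.eq_of_subset_of_card_le hcon (by rw [(hE f hf).2, (hE g hg).2]))
  obtain ⟨q, hqf, hqg⟩ := hdiff f g hf hg hfg
  obtain ⟨p, hpg, hpf⟩ := hdiff g f hg hf hfg.symm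
  have hqx : q ≠ x := fun h => hqg (h ▸ hxg)
  have hpx : p ≠ x := fun h => hpf (h ▸ hxf)
  have hqp : q ≠ p := fun h => hpf (h ▸ hqf)
  obtain ⟨c, hcS, hcinj, hc⟩ := exists_enumeration S [q, x, p]
    (by simp [hqx, hqp, hpx.symm]) (by
      intro v hv
      simp only [List.mem_cons, List.not_mem_nil, or_false] at hv
      rcases hv with rfl | rfl | rfl
      exacts [(hE f hf).1 hqf, hx, (hE g hg).1 hpg]) ⟨x, hx⟩
  have hc0 : c 0 = q := hc 0 (by simp)
  have hc1 : c 1 = x := hc 1 (by simp)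
  have hc2 : c 2 = p := hc 2 (by simp)
  rw [hS] at hcinj
  set C : Fin (r + 2) → V := fun i => c i with hC
  have hCinj : ∀ i j, C i = C j → i = j := fun i j h => Fin.ext (hcinj i j i.2 j.2 h)
  have hCx : ∀ i : Fin (r + 2), C i = x ↔ (i : ℕ) = 1 := by
    intro i
    constructor
    · intro h
      exact hcinj _ _ i.2 (by omega) (h.trans hc1.symm)
    · intro h
      simp only [hC, h, hc1]
  have hdegC : ∀ i, (E.filter (x ∈ ·)).card ≤ (E.filter (C i ∈ ·)).card := fun i => hmin _ (hcS i)
  set t : Fin (r + 2) → Finset (Finset V) :=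
    fun i => E.filter fun e => C i ∈ e ∧ C (i + 1) ∈ e with ht
  have hmemt : ∀ i e, e ∈ t i ↔ e ∈ E ∧ C i ∈ e ∧ C (i + 1) ∈ e := fun i e => Finset.mem_filter
  -- edges outside `t i` for all `i ∈ A` are determined by their complements
  have hbad : ∀ A : Finset (Fin (r + 2)),
      E.card ≤ (A.biUnion t).card + (pairTransversals A).card := by
    intro A
    have hsub : E ⊆ A.biUnion t ∪ (E \ A.biUnion t) := by
      intro e he
      by_cases h : e ∈ A.biUnion t <;> simp [h, he]
    refine (Finset.card_le_card hsub).trans ((Finset.card_union_le _ _).trans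
      (Nat.add_le_add_left ?_ _))
    have himg : ∀ e ∈ E, (Finset.univ.filter fun i => C i ∈ e).image C = e := by
      intro e he
      ext w
      simp only [Finset.mem_image, Finset.mem_filter, Finset.mem_univ, true_and]
      constructor
      · rintro ⟨i, hi, rfl⟩
        exact hi
      · intro hw
        obtain ⟨i, hi, rfl⟩ := exists_vert_of_injOn hcS (by rw [hS]; exact hcinj) ((hE e he).1 hw)
        exact ⟨⟨i, by omega⟩, hw, rfl⟩
    refine Finset.card_le_card_of_injOn (fun e => Finset.univ.filter fun i => C i ∉ e) ?_ ?_
    · intro e he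
      obtain ⟨he, heA⟩ := Finset.mem_sdiff.1 he
      refine Finset.mem_filter.2 ⟨Finset.mem_powersetCard.2 ⟨Finset.subset_univ _, ?_⟩, ?_⟩
      · have h1 := Finset.card_filter_add_card_filter_not
          (s := (Finset.univ : Finset (Fin (r + 2)))) (fun i => C i ∈ e)
        have h2 : (Finset.univ.filter fun i => C i ∈ e).card = e.card := by
          conv_rhs => rw [← himg e he]
          exact (Finset.card_image_of_injOn fun i _ j _ h => hCinj i j h).symm
        rw [Finset.card_univ, Fintype.card_fin, h2, (hE e he).2] at h1
        change (Finset.univ.filter fun i => C i ∉ e).card = 2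
        omega
      · intro i hi
        by_contra hcon
        simp only [Finset.mem_filter, Finset.mem_univ, true_and, not_or, not_not] at hcon
        exact heA (Finset.mem_biUnion.2 ⟨i, hi, (hmemt i e).2 ⟨he, hcon⟩⟩)
    · intro e he e' he' heq
      have he := (Finset.mem_sdiff.1 he).1
      have he' := (Finset.mem_sdiff.1 he').1
      rw [← himg e he, ← himg e' he']
      congr 1
      ext i
      have := Finset.ext_iff.1 heq i
      simp only [Finset.mem_filter, Finset.mem_univ, true_and] at this ⊢
      tauto
  have hval0 : C 0 = q := hc0
  have hval1 : ((0 : Fin (r + 2)) + 1 : Fin (r + 2)).val = 1 := by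
    rw [Fin.val_add_one_of_lt' (by simp)]
    simp
  have hf0 : f ∈ t 0 := (hmemt 0 f).2 ⟨hf, hval0 ▸ hqf, ((hCx _).2 hval1).symm ▸ hxf⟩
  have hg1 : ∀ i : Fin (r + 2), (i : ℕ) = 1 → g ∈ t i := by
    intro i hi
    refine (hmemt i g).2 ⟨hg, ((hCx i).2 hi).symm ▸ hxg, ?_⟩
    have h1 : ((i + 1 : Fin (r + 2)) : ℕ) = 2 := by
      have := val_add_one_cases i
      omega
    simp only [hC, h1, hc2]
    exact hpg
  have hsingle : ∀ i, ∃ e, e ∈ t i := by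
    intro i
    rcases (show (i : ℕ) = 0 ∨ (i : ℕ) = 1 ∨ 2 ≤ (i : ℕ) by omega) with h | h | h
    · have : i = 0 := Fin.ext h
      exact ⟨f, this ▸ hf0⟩
    · exact ⟨g, hg1 i h⟩
    · have hi := val_add_one_cases i
      obtain ⟨e, he, h1, h2⟩ := exists_mem_mem_of_min_degree hS hE (by omega) hx (hcS i)
        (hcS (i + 1 : Fin (r + 2))) (fun h' => by have := (hCx i).1 h'.symm; omega)
        (fun h' => by have := (hCx (i + 1)).1 h'.symm; omega) (hdegC i) (hdegC (i + 1))
      exact ⟨e, (hmemt i e).2 ⟨he, h1, h2⟩⟩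
  have hconsec : ∀ i, 2 ≤ (t i ∪ t (i + 1)).card := by
    intro i
    by_cases h : ((i + 1 : Fin (r + 2)) : ℕ) = 1
    · have hi := val_add_one_cases i
      have h0 : i = 0 := Fin.ext (by rw [Fin.val_zero]; omega)
      refine Finset.one_lt_card.2 ⟨f, ?_, g, ?_, hfg⟩
      · exact Finset.mem_union_left _ (h0 ▸ hf0)
      · exact Finset.mem_union_right _ (hg1 _ h)
    · have hi := val_add_one_cases i
      have hi' := val_add_one_cases (i + 1)
      have hne : C i ≠ C (i + 1 + 1) := by
        intro h'
        have := congrArg Fin.val (hCinj _ _ h')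
        omega
      refine (two_le_card_filter_of_min_degree hS hE (by omega) hx (hcS i)
        (hcS (i + 1 : Fin (r + 2))) (hcS (i + 1 + 1 : Fin (r + 2)))
        (fun h' => h ((hCx _).1 h'.symm)) hne (hdegC (i + 1))).trans (Finset.card_le_card ?_)
      intro e he
      obtain ⟨he, hb, ha | hd⟩ := Finset.mem_filter.1 he
      · exact Finset.mem_union_left _ ((hmemt _ _).2 ⟨he, ha, hb⟩)
      · exact Finset.mem_union_right _ ((hmemt _ _).2 ⟨he, hb, hd⟩)
  have hhall : ∀ A : Finset (Fin (r + 2)), A.card ≤ (A.biUnion t).card := by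
    intro A
    rcases (show A.card = 0 ∨ A.card = 1 ∨ A.card = 2 ∨ 3 ≤ A.card by omega) with h | h | h | h
    · omega
    · obtain ⟨i, rfl⟩ := Finset.card_eq_one.1 h
      obtain ⟨e, he⟩ := hsingle i
      rw [h]
      exact Finset.card_pos.2 ⟨e, by simpa using he⟩
    · obtain ⟨i, j, hij, rfl⟩ := Finset.card_eq_two.1 h
      rw [h]
      by_cases h1 : j = i + 1
      · simpa [h1] using hconsec i
      by_cases h2 : i = j + 1
      · simpa [h2, Finset.union_comm] using hconsec j
      have h3 := hbad {i, j}
      have h4 := card_pairTransversals_le_four (A := {i, j}) (i := i) (j := j) (by simp) (by simp)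
        hij h2 h1
      omega
    · have h1 := hbad A
      have h2 := card_add_card_pairTransversals_le hr h
      omega
  obtain ⟨φ, hφinj, hφ⟩ := (Finset.all_card_le_biUnion_card_iff_exists_injective t).1 hhall
  have hφ' := fun i => (hmemt i _).1 (hφ i)
  refine exists_isHamCycle (N := r + 2) (c := c)
    (ε := fun k => if h : k < r + 2 then φ ⟨k, h⟩ else ∅) hS (by omega) (fun i _ => hcS i)
    (fun i hi => ?_) (fun i hi => ?_) (fun i hi => ?_) ?_ hcinj (fun i j hi hj h => ?_)
  · rw [dif_pos hi]
    exact (hφ' _).1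
  · rw [dif_pos hi]
    exact (hφ' ⟨i, hi⟩).2.1
  · rw [dif_pos (by omega)]
    have h1 := (hφ' ⟨i, by omega⟩).2.2
    have h2 := val_add_one_cases (⟨i, by omega⟩ : Fin (r + 2))
    have h3 : ((⟨i, by omega⟩ + 1 : Fin (r + 2)) : ℕ) = i + 1 := by
      simp only at h2
      omega
    simpa only [hC, h3] using h1
  · rw [dif_pos (by omega)]
    have h1 := (hφ' ⟨r + 2 - 1, by omega⟩).2.2
    have h2 := val_add_one_cases (⟨r + 2 - 1, by omega⟩ : Fin (r + 2))
    have h3 : ((⟨r + 2 - 1, by omega⟩ + 1 : Fin (r + 2)) : ℕ) = 0 := by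
      simp only at h2
      omega
    simpa only [hC, h3] using h1
  · rw [dif_pos hi, dif_pos hj] at h
    simpa using hφinj h

end codimension_two

/-! ### Hamiltonian Berge cycles and paths from the number of edges -/

section edge_count

variable {V : Type*} [DecidableEq V] {E : Finset (Finset V)} {S : Finset V} {r : ℕ}

theorem card_filter_notMem_le (hE : ∀ e ∈ E, e ⊆ S ∧ e.card = r) {v : V} (hv : v ∈ S) :
    (E.filter (v ∉ ·)).card ≤ (S.card - 1).choose r := by
  rw [← Finset.card_erase_of_mem hv, ← Finset.card_powersetCard]
  refine Finset.card_le_card fun e he => ?_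
  obtain ⟨he, hve⟩ := Finset.mem_filter.1 he
  exact Finset.mem_powersetCard.2 ⟨Finset.subset_erase.2 ⟨(hE e he).1, hve⟩, (hE e he).2⟩

theorem sum_degree_eq (hE : ∀ e ∈ E, e ⊆ S ∧ e.card = r) :
    ∑ v ∈ S, (E.filter (v ∈ ·)).card = r * E.card := by
  have h := Finset.sum_card_bipartiteAbove_eq_sum_card_bipartiteBelow (s := S) (t := E)
    (fun v e => v ∈ e)
  simp only [Finset.bipartiteAbove, Finset.bipartiteBelow] at h
  rw [h, mul_comm, ← smul_eq_mul, ← Finset.sum_const]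
  refine Finset.sum_congr rfl fun e he => ?_
  rw [Finset.filter_mem_eq_inter, Finset.inter_eq_right.2 (hE e he).1, (hE e he).2]

/-- Deleting a vertex of degree at most the average `r * M / (n + 1)` keeps the edge number above
the threshold, with one edge to spare. -/
theorem choose_add_two_le_of_degree_le {n r M δ : ℕ} (hr : 3 ≤ r) (hn : r + 2 ≤ n)
    (hM : n.choose r + 1 ≤ M) (hδ : (n + 1) * δ ≤ r * M) (hδM : δ ≤ M) :
    (n - 1).choose r + 2 ≤ M - δ := by
  obtain ⟨d, rfl⟩ : ∃ d, n = r + d := ⟨n - r, by omega⟩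
  have hβ : r + d - 1 ≤ (r + d - 1).choose (r - 1) := le_choose_self (by omega) (by omega)
  have h1 := Nat.choose_succ_right_eq (r + d - 1) (r - 1)
  rw [show r - 1 + 1 = r by omega, show r + d - 1 - (r - 1) = d by omega] at h1
  have h2 : (r + d).choose r = (r + d - 1).choose (r - 1) + (r + d - 1).choose r := by
    have := Nat.choose_succ_succ' (r + d - 1) (r - 1)
    rwa [show r - 1 + 1 = r by omega, show r + d - 1 + 1 = r + d by omega] at this
  set α := (r + d - 1).choose r
  set β := (r + d - 1).choose (r - 1)
  obtain ⟨m, rfl⟩ : ∃ m, M = δ + m := ⟨M - δ, by omega⟩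
  rw [h2] at hM
  rw [Nat.add_sub_cancel_left]
  by_contra hcon
  have hm : m ≤ α + 1 := by omega
  have h3 : (d + 1) * (β + α + 1) ≤ (d + 1) * (δ + m) := Nat.mul_le_mul_left _ hM
  have h4 : (r + d + 1) * m ≤ (r + d + 1) * (α + 1) := Nat.mul_le_mul_left _ hm
  have h5 : r + 1 ≤ β := by omega
  nlinarith

/-- An `r`-graph with more edges than `K_{n-1}^r` in which every vertex lies in two edges has
a Hamiltonian Berge cycle. -/
theorem exists_isHamCycle_of_choose_lt_card (hr : 3 ≤ r) {n : ℕ} (hn : r + 2 ≤ n) :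
    ∀ (S : Finset V) (E : Finset (Finset V)), S.card = n → (∀ e ∈ E, e ⊆ S ∧ e.card = r) →
      (n - 1).choose r + 1 ≤ E.card → (∀ v ∈ S, 2 ≤ (E.filter (v ∈ ·)).card) →
      ∃ c ε, IsHamCycle E S c ε := by
  induction n, hn using Nat.le_induction with
  | base =>
    intro S E hS hE hcard hdeg
    have hcard' : r + 2 ≤ E.card := by
      rw [show r + 2 - 1 = r + 1 by omega, Nat.choose_succ_self_right] at hcard
      exact hcard
    rcases hr.eq_or_lt with rfl | hr
    · exact exists_isHamCycle_of_card_eq_five hS hE hcard' hdeg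
    · exact exists_isHamCycle_of_card_eq_add_two hr hS hE hcard' hdeg
  | succ n hn ih =>
    intro S E hS hE hcard hdeg
    rw [Nat.add_sub_cancel] at hcard
    obtain ⟨v, hv, hmin⟩ := S.exists_min_image (fun v => (E.filter (v ∈ ·)).card)
      (Finset.card_pos.1 (by omega))
    have hδ : (n + 1) * (E.filter (v ∈ ·)).card ≤ r * E.card := by
      rw [← sum_degree_eq hE, ← hS, ← smul_eq_mul]
      exact Finset.card_nsmul_le_sum _ _ _ hmin
    have hS' : (S.erase v).card = n := by rw [Finset.card_erase_of_mem hv, hS, Nat.add_sub_cancel]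
    have hE' : ∀ e ∈ E.filter (v ∉ ·), e ⊆ S.erase v ∧ e.card = r := by
      intro e he
      obtain ⟨he, hve⟩ := Finset.mem_filter.1 he
      exact ⟨Finset.subset_erase.2 ⟨(hE e he).1, hve⟩, (hE e he).2⟩
    have hcard' : (n - 1).choose r + 2 ≤ (E.filter (v ∉ ·)).card := by
      have h1 := Finset.card_filter_add_card_filter_not (s := E) (v ∈ ·)
      have h2 := choose_add_two_le_of_degree_le hr hn hcard hδ (Finset.card_filter_le _ _)
      omega
    have hdeg' : ∀ w ∈ S.erase v, 2 ≤ ((E.filter (v ∉ ·)).filter (w ∈ ·)).card := by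
      intro w hw
      have h1 := card_filter_notMem_le hE' hw
      have h2 := Finset.card_filter_add_card_filter_not (s := E.filter (v ∉ ·)) (w ∈ ·)
      rw [hS'] at h1
      omega
    obtain ⟨c, ε, h⟩ := ih (S.erase v) _ hS' hE' (by omega) hdeg'
    have hvS := Finset.notMem_erase v S
    have hins := Finset.insert_erase hv
    rw [← hins] at hE ⊢
    rcases Nat.lt_or_ge (E.filter (v ∈ ·)).card 4 with h4 | h4
    · exact exists_isHamCycle_insert_of_card_le_three h hvS hE (by rw [hS']; exact hcard) hr
        (by rw [hS']; exact hn) (hdeg v hv) (by omega)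
    · exact exists_isHamCycle_insert_of_four_le h hvS hE (by rw [hS']; exact hcard) hr h4

/-- An `r`-graph with at least as many edges as `K_{n-1}^r` and without isolated vertices acquires
a Hamiltonian Berge cycle by the addition of at most one edge. -/
theorem exists_isHamCycle_insert_of_choose_le_card (hr : 3 ≤ r) (hS : r + 2 ≤ S.card)
    (hE : ∀ e ∈ E, e ⊆ S ∧ e.card = r) (hcard : (S.card - 1).choose r ≤ E.card)
    (hdeg : ∀ v ∈ S, 1 ≤ (E.filter (v ∈ ·)).card) :
    ∃ f c ε, IsHamCycle (insert f E) S c ε := by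
  suffices h : ∃ f, f ⊆ S ∧ f.card = r ∧ (S.card - 1).choose r + 1 ≤ (insert f E).card ∧
      ∀ v ∈ S, 2 ≤ ((insert f E).filter (v ∈ ·)).card by
    obtain ⟨f, hfS, hfr, hf, hdeg⟩ := h
    refine ⟨f, exists_isHamCycle_of_choose_lt_card hr hS S _ rfl (fun e he => ?_) hf hdeg⟩
    rcases Finset.mem_insert.1 he with rfl | he
    exacts [⟨hfS, hfr⟩, hE e he]
  have hmono : ∀ f w, (E.filter (w ∈ ·)).card ≤ ((insert f E).filter (w ∈ ·)).card := fun f w =>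
    Finset.card_le_card (Finset.filter_subset_filter _ (Finset.subset_insert _ _))
  have hβ : S.card - 1 ≤ (S.card - 1).choose (r - 1) := le_choose_self (by omega) (by omega)
  by_cases hd : ∀ v ∈ S, 2 ≤ (E.filter (v ∈ ·)).card
  · rcases hcard.eq_or_lt with heq | hlt
    · obtain ⟨f, hf, hfE⟩ : ∃ f ∈ S.powersetCard r, f ∉ E := by
        by_contra hcon
        push Not at hcon
        have h1 := Finset.card_le_card hcon
        rw [Finset.card_powersetCard, ← heq] at h1
        have h2 := Nat.choose_succ_succ' (S.card - 1) (r - 1)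
        rw [show r - 1 + 1 = r by omega, show S.card - 1 + 1 = S.card by omega] at h2
        omega
      obtain ⟨hfS, hfr⟩ := Finset.mem_powersetCard.1 hf
      exact ⟨f, hfS, hfr, by rw [Finset.card_insert_of_notMem hfE, heq],
        fun v hv => (hd v hv).trans (hmono f v)⟩
    · obtain ⟨f, hf⟩ := Finset.card_pos.1 (Nat.zero_lt_of_lt hlt)
      refine ⟨f, (hE f hf).1, (hE f hf).2, ?_⟩
      rw [Finset.insert_eq_of_mem hf]
      exact ⟨hlt, hd⟩
  · push Not at hd
    obtain ⟨v, hv, hdv⟩ := hd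
    -- the additional edge is placed at the vertex `v` of degree one
    obtain ⟨f, hf, hfE⟩ : ∃ f ∈ extFamily {v} (S.erase v) (r - 1), f ∉ E := by
      by_contra hcon
      push Not at hcon
      have h1 : extFamily {v} (S.erase v) (r - 1) ⊆ E.filter (v ∈ ·) := by
        intro f hf
        refine Finset.mem_filter.2 ⟨hcon f hf, ?_⟩
        obtain ⟨g, -, -, rfl⟩ := mem_extFamily.1 hf
        simp
      have h2 := Finset.card_le_card h1
      rw [card_extFamily (by simp), Finset.card_erase_of_mem hv] at h2
      omega
    obtain ⟨hfS, hfr⟩ := Finset.mem_powersetCard.1 (extFamily_subset (r := r) (by simp)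
      (Finset.singleton_subset_iff.2 hv) (Finset.erase_subset _ _) (by simp; omega) hf)
    have hvf : v ∈ f := by
      obtain ⟨g, -, -, rfl⟩ := mem_extFamily.1 hf
      simp
    refine ⟨f, hfS, hfr, by rw [Finset.card_insert_of_notMem hfE]; omega, fun w hw => ?_⟩
    by_cases hwv : w = v
    · subst hwv
      rw [Finset.filter_insert, if_pos hvf, Finset.card_insert_of_notMem
        (fun h => hfE (Finset.mem_filter.1 h).1)]
      have := hdeg w hw
      omega
    · refine le_trans ?_ (hmono f w)
      have hE' : ∀ e ∈ E.filter (v ∉ ·), e ⊆ S.erase v ∧ e.card = r := by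
        intro e he
        obtain ⟨he, hve⟩ := Finset.mem_filter.1 he
        exact ⟨Finset.subset_erase.2 ⟨(hE e he).1, hve⟩, (hE e he).2⟩
      have h1 := card_filter_notMem_le hE' (Finset.mem_erase.2 ⟨hwv, hw⟩)
      have h2 := Finset.card_filter_add_card_filter_not (s := E) (v ∈ ·)
      have h3 := Finset.card_filter_add_card_filter_not (s := E.filter (v ∉ ·)) (w ∈ ·)
      have h4 : ((E.filter (v ∉ ·)).filter (w ∈ ·)).card ≤ (E.filter (w ∈ ·)).card :=
        Finset.card_le_card (Finset.filter_subset_filter _ (Finset.filter_subset _ _))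
      have h5 := Nat.choose_succ_succ' (S.card - 2) (r - 1)
      rw [show r - 1 + 1 = r by omega, show S.card - 2 + 1 = S.card - 1 by omega] at h5
      have h6 : S.card - 2 ≤ (S.card - 2).choose (r - 1) := le_choose_self (by omega) (by omega)
      rw [Finset.card_erase_of_mem hv, show S.card - 1 - 1 = S.card - 2 by omega] at h1
      omega

end edge_count

/-! ### The extremal hypergraphs -/

theorem mem_complete_addVertex_edges {m r : ℕ} {f : Finset (Option (Fin m))} :
    f ∈ (complete m r).addVertex.edges ↔ f.card = r ∧ none ∉ f := by
  constructor
  · intro h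
    obtain ⟨g, -, rfl⟩ := Finset.mem_map.1 h
    refine ⟨(complete m r).addVertex.uniform _ h, ?_⟩
    simp [Finset.mapEmbedding]
  · rintro ⟨hf, hnone⟩
    have h1 : (Finset.eraseNone f).map Function.Embedding.some = f := by
      rw [Finset.map_some_eraseNone, Finset.erase_eq_of_notMem hnone]
    refine Finset.mem_map.2 ⟨Finset.eraseNone f, ?_, h1⟩
    refine Finset.mem_powersetCard.2 ⟨Finset.subset_univ _, ?_⟩
    rw [← hf]
    conv_rhs => rw [← h1]
    rw [Finset.card_map]

theorem exists_equiv_option {V : Type*} [Fintype V] {m : ℕ} (hV : Fintype.card V = m + 1) (v : V) :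
    ∃ σ : V ≃ Option (Fin m), σ v = none := by
  classical
  have σ : V ≃ Option (Fin m) := Fintype.equivOfCardEq (by simp [hV])
  exact ⟨σ.trans (Equiv.swap (σ v) none), by simp⟩

theorem none_mem_map_iff {V : Type*} {m : ℕ} {v : V} {σ : V ≃ Option (Fin m)} (hσ : σ v = none) (e : Finset V) :
    none ∈ e.map σ.toEmbedding ↔ v ∈ e := by
  rw [← hσ]
  exact Finset.mem_map' σ.toEmbedding

section extremal

variable {V : Type*} [Fintype V] [DecidableEq V] {r m : ℕ} {H : RGraph V r}

theorem mem_edges_of_choose_le_card_filter (hV : Fintype.card V = m + 1) {v : V}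
    (h : m.choose r ≤ (H.edges.filter (v ∉ ·)).card) {e : Finset V} (he : e.card = r)
    (hve : v ∉ e) : e ∈ H.edges := by
  have hsub : H.edges.filter (v ∉ ·) ⊆ (Finset.univ.erase v).powersetCard r := by
    intro f hf
    obtain ⟨hf, hvf⟩ := Finset.mem_filter.1 hf
    exact Finset.mem_powersetCard.2 ⟨Finset.subset_erase.2 ⟨Finset.subset_univ _, hvf⟩,
      H.uniform f hf⟩
  have heq := Finset.eq_of_subset_of_card_le hsub (by
    rwa [Finset.card_powersetCard, Finset.card_erase_of_mem (Finset.mem_univ v),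
      Finset.card_univ, hV, Nat.add_sub_cancel])
  have : e ∈ H.edges.filter (v ∉ ·) := by
    rw [heq]
    exact Finset.mem_powersetCard.2 ⟨Finset.subset_erase.2 ⟨Finset.subset_univ _, hve⟩, he⟩
  exact (Finset.mem_filter.1 this).1

theorem isCompletePlusVertex_of_degree_eq_zero (hV : Fintype.card V = m + 1)
    (hcard : m.choose r ≤ H.edges.card) {v : V} (hv : (H.edges.filter (v ∈ ·)).card = 0) :
    H.IsCompletePlusVertex m := by
  obtain ⟨σ, hσ⟩ := exists_equiv_option hV v
  have hsum := Finset.card_filter_add_card_filter_not (s := H.edges) (v ∈ ·)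
  refine ⟨σ, fun e => ?_⟩
  rw [mem_complete_addVertex_edges, Finset.card_map, none_mem_map_iff hσ]
  constructor
  · intro he
    refine ⟨H.uniform e he, fun hve => ?_⟩
    rw [Finset.card_eq_zero] at hv
    exact Finset.notMem_empty e (hv ▸ Finset.mem_filter.2 ⟨he, hve⟩)
  · rintro ⟨he, hve⟩
    exact mem_edges_of_choose_le_card_filter hV (by omega) he hve

theorem isCompletePlusEdge_of_degree_le_one (hV : Fintype.card V = m + 1)
    (hcard : m.choose r + 1 ≤ H.edges.card) {v : V} (hv : (H.edges.filter (v ∈ ·)).card ≤ 1) :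
    H.IsCompletePlusEdge m := by
  obtain ⟨σ, hσ⟩ := exists_equiv_option hV v
  have hsum := Finset.card_filter_add_card_filter_not (s := H.edges) (v ∈ ·)
  have hle := card_filter_notMem_le (S := Finset.univ)
    (fun e he => ⟨Finset.subset_univ e, H.uniform e he⟩) (Finset.mem_univ v)
  rw [Finset.card_univ, hV, Nat.add_sub_cancel] at hle
  obtain ⟨f, hf⟩ := Finset.card_eq_one.1 (show (H.edges.filter (v ∈ ·)).card = 1 by omega)
  have hfE : f ∈ H.edges ∧ v ∈ f := Finset.mem_filter.1 (hf ▸ Finset.mem_singleton_self f)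
  refine ⟨f.map σ.toEmbedding, by rw [Finset.card_map, H.uniform f hfE.1],
    (none_mem_map_iff hσ f).2 hfE.2, σ, fun e => ?_⟩
  change _ ↔ _ ∈ insert _ _
  rw [Finset.mem_insert, mem_complete_addVertex_edges, Finset.card_map, none_mem_map_iff hσ,
    Finset.map_inj]
  constructor
  · intro he
    by_cases hve : v ∈ e
    · exact Or.inl (Finset.mem_singleton.1 (hf ▸ Finset.mem_filter.2 ⟨he, hve⟩))
    · exact Or.inr ⟨H.uniform e he, hve⟩
  · rintro (rfl | ⟨he, hve⟩)
    · exact hfE.1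
    · exact mem_edges_of_choose_le_card_filter hV (by omega) he hve

end extremal

end RGraph

theorem mainTheorem2 {V : Type*} [Fintype V] (n r : ℕ) (hr : 3 ≤ r) (hn : r + 2 ≤ n)
    (hV : Fintype.card V = n) (H : RGraph V r) :
    (((n - 2).choose (r - 1) : ℝ) ≤ H.spectralRadius →
      ¬ H.IsCompletePlusVertex (n - 1) → H.HasHamiltonianBergePath) ∧
    (((n - 2).choose (r - 1) : ℝ) < H.spectralRadius →
      ¬ H.IsCompletePlusEdge (n - 1) → H.HasHamiltonianBergeCycle) := by
  classical
  have : Nonempty V := Fintype.card_pos_iff.1 (by omega)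
  have hV' : Fintype.card V = n - 1 + 1 := by omega
  have hE : ∀ e ∈ H.edges, e ⊆ Finset.univ ∧ e.card = r := fun e he =>
    ⟨Finset.subset_univ e, H.uniform e he⟩
  have hn2 : n - 2 = n - 1 - 1 := by omega
  constructor
  · intro hspec hnot
    rw [hn2] at hspec
    have hcard := H.choose_le_card_of_le_spectralRadius (by omega) (by omega) hspec
    obtain ⟨f, c, ε, h⟩ := RGraph.exists_isHamCycle_insert_of_choose_le_card
      (S := Finset.univ) hr (by rwa [Finset.card_univ, hV]) hE
      (by rwa [Finset.card_univ, hV]) fun v _ => by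
        by_contra hv
        exact hnot (RGraph.isCompletePlusVertex_of_degree_eq_zero hV' hcard (v := v) (by omega))
    exact h.hasHamiltonianBergePath
  · intro hspec hnot
    rw [hn2] at hspec
    have hcard := H.choose_lt_card_of_lt_spectralRadius (by omega) (by omega) hspec
    obtain ⟨c, ε, h⟩ := RGraph.exists_isHamCycle_of_choose_lt_card hr hn Finset.univ H.edges
      (by rw [Finset.card_univ, hV]) hE hcard fun v _ => by
        by_contra hv
        exact hnot (RGraph.isCompletePlusEdge_of_degree_le_one hV' hcard (v := v) (by omega))
    exact h.hasHamiltonianBergeCycle
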